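/- All vector spaces are over $\mathbb C$. Let $a_\infty=\bar a_\infty\oplus\mathbb C c$, where $\bar a_\infty$ is the Lie algebra of matrices $(a_{ij})_{i,j\in\mathbb Z}$ with $a_{ij}=0$ for $|i-j|\gg 0$, $c$ is central, and $$[A,B]=AB-BA+C(A,B)\,c,\qquad C(A,B)=\mathrm{Trace}([J,A]B),\qquad J=\sum_{i\le 0}E_{ii}.$$ Let $a_\infty^+$ be the strictly upper triangular matrices and $a_\infty^0$ the sum of the diagonal matrices and $\mathbb Cc$. For $n\in\mathbb Z$ let ${}^a\hat\Lambda_n\in(a^0_\infty)^*$ be given by ${}^a\hat\Lambda_n(c)=1$ and $${}^a\hat\Lambda_n(\mathrm{diag}(d_i)_{i\in\mathbb Z})=\sum_{0<i\le n}d_i-\sum_{n<i\le 0}d_i .$$ Let $L(a_\infty;{}^a\hat\Lambda_n,1)$ be the irreducible highest weight module, i.e. the quotient of the Verma module of highest weight ${}^a\hat\Lambda_n$ by the sum of its proper submodules; the Verma module is $U(a_\infty)$ modulo the left ideal generated by $a_\infty^+$ and all $h-{}^a\hat\Lambda_n(h)$, $h\in a_\infty^0$. Let $F^{\otimes\frac12}$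 be the Fock space of a single neutral fermion: the module over the Clifford algebra with generators $\phi_m$, $m\in\mathbb Z+\frac12$, and relations $\{\phi_m,\phi_n\}=\delta_{m,-n}$, generated by a vacuum $|0\rangle$ subject to $\phi_m|0\rangle=0$ for $m>0$. For $n\in\mathbb Z$ let $F^{\otimes\frac12}_{(n)}$ be the span of the basis monomials $\phi_{-n_k-\frac12}\cdots\phi_{-n_1-\frac12}|0\rangle$, $n_k>\dots>n_1\ge 0$, $k\ge0$, with $\#\{i: n_i\text{ odd}\}-\#\{i: n_i\text{ even}\}=n$. Let $a_\infty$ act on $F^{\otimes\frac12}$ by the representation $r_1$ given by $r_1(c)=1$ and $$r_1\big((a_{ij})\big)=\sum_{i,j}a_{ij}\,{:}\phi_{-2i+\frac12}\phi_{2j-\frac12}{:}\,,$$ where only finitely many terms are nonzero on each vector, and ${:}\phi_{-2i+\frac12}\phi_{2j-\frac12}{:}$ is $-\phi_{2j-\frac12}\phi_{-2i+\frac12}$ if $i=j\le 0$ and $\phi_{-2i+\frac12}\phi_{2j-\frac12}$ otherwise. Let $F^{\otimes 1}$ be the Fock space of a pair of charged free fermions: the module over the Clifford algebra with generators $\psi^\pm_n$,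 $n\in\mathbb Z$, and relations $\{\psi^+_m,\psi^-_n\}=\delta_{m+n,-1}$, $\{\psi^\pm_m,\psi^\pm_n\}=0$, generated by a vacuum $|0\rangle$ subject to $\psi^\pm_n|0\rangle=0$ for $n\ge 0$. Let $a_\infty$ act on it in the standard way, $c\mapsto 1$ and $(a_{ij})\mapsto\sum_{i,j}a_{ij}\,{:}\psi^+_{-i}\psi^-_{j-1}{:}$, where ${:}\psi^+_{-i}\psi^-_{j-1}{:}$ is $-\psi^-_{j-1}\psi^+_{-i}$ if $i=j\le0$ and $\psi^+_{-i}\psi^-_{j-1}$ otherwise. **Theorem.** As $a_\infty$-modules with central charge $c=1$: for every $n\in\mathbb Z$, $F^{\otimes\frac12}_{(n)}$ is an irreducible submodule of $F^{\otimes\frac12}$ and $F^{\otimes\frac12}_{(n)}\cong L(a_\infty;{}^a\hat\Lambda_n,1)$. The space $F^{\otimes\frac12}$ is the internal direct sum of the submodules $F^{\otimes\frac12}_{(n)}$, $n\in\mathbb Z$, so that $$F^{\otimes\frac12}\cong\bigoplus_{n\in\mathbb Z}L(a_\infty;{}^a\hat\Lambda_n,1).$$ Moreover $F^{\otimes\frac12}\cong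 F^{\otimes1}$ as $a_\infty$-modules with central charge $c=1$. -/

import Mathlib

namespace FermionFock

open Filter

noncomputable section

/-- The space of complex matrices `(a i j)`, `i j : ℤ`, with `a i j = 0` for `|i - j| ≫ 0`. -/
def bandMatrices : Submodule ℂ (Matrix ℤ ℤ ℂ) where
  carrier := {A | ∃ N : ℕ, ∀ i j : ℤ, (N : ℤ) < |i - j| → A i j = 0}
  zero_mem' := ⟨0, fun _ _ _ => rfl⟩
  add_mem' := by
    rintro A B ⟨N, hN⟩ ⟨M, hM⟩
    refine ⟨max N M, fun i j h => ?_⟩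
    push_cast at h
    rw [Matrix.add_apply, hN i j (lt_of_le_of_lt (le_max_left _ _) h),
      hM i j (lt_of_le_of_lt (le_max_right _ _) h), add_zero]
  smul_mem' := by
    rintro c A ⟨N, hN⟩
    exact ⟨N, fun i j h => by rw [Matrix.smul_apply, hN i j h, smul_zero]⟩

/-- The underlying space of the Lie algebra of infinite band matrices. -/
abbrev Band : Type := ↥bandMatrices

@[ext] theorem Band.ext' {A B : Band} (h : ∀ i j, A.1 i j = B.1 i j) : A = B :=
  Subtype.ext (Matrix.ext h)

/-- Matrix multiplication: `(A B)_{ik} = ∑_j a_{ij} b_{jk}`, a sum with finitely many nonzero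
terms. -/
instance : Mul Band where
  mul A B := ⟨fun i k => ∑ᶠ j : ℤ, A.1 i j * B.1 j k, by
    obtain ⟨N, hN⟩ := A.2
    obtain ⟨M, hM⟩ := B.2
    refine ⟨N + M, fun i k h => ?_⟩
    have h0 : (fun j : ℤ => A.1 i j * B.1 j k) = fun _ => 0 := by
      funext j
      by_cases h1 : (N : ℤ) < |i - j|
      · rw [hN i j h1, zero_mul]
      · rw [hM j k, mul_zero]
        have := abs_sub_le i j k
        push_cast at h
        omega
    exact (congrArg finsum h0).trans finsum_zero⟩

theorem Band.mul_apply (A B : Band) (i k : ℤ) :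
    (A * B).1 i k = ∑ᶠ j : ℤ, A.1 i j * B.1 j k := rfl

/-- The elementary matrix `E_{mn}`. -/
def E (m n : ℤ) : Band :=
  ⟨fun i j => if i = m ∧ j = n then 1 else 0, (m - n).natAbs, fun i j h => by
    refine if_neg ?_
    rintro ⟨rfl, rfl⟩
    rw [Int.abs_eq_natAbs] at h
    exact lt_irrefl _ h⟩

/-- The diagonal matrix `J = ∑_{i ≤ 0} E_{ii}`. -/
def J : Band :=
  ⟨fun i j => if i = j ∧ i ≤ 0 then 1 else 0, 0, fun i j h => by
    refine if_neg ?_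
    rintro ⟨rfl, -⟩
    simp at h⟩

/-- The two-cocycle `C(A, B) = Trace([J, A] B)` (only finitely many diagonal entries of
`[J, A] B` are nonzero). -/
def cocycle (A B : Band) : ℂ := ∑ᶠ i : ℤ, ((J * A - A * J) * B).1 i i

/-- The indicator of `i ≤ 0`. -/
def ind (i : ℤ) : ℂ := if i ≤ 0 then 1 else 0

/-- The box `{-M, …, M}`. -/
abbrev box (M : ℕ) : Finset ℤ := Finset.Icc (-(M : ℤ)) M

theorem not_mem_box {M : ℕ} {j : ℤ} (h : j ∉ box M) : j < -(M : ℤ) ∨ (M : ℤ) < j := by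
  rw [Finset.mem_Icc] at h
  omega

theorem Band.mul_apply_eq (A B : Band) (i k : ℤ) (s : Finset ℤ)
    (h : ∀ j, j ∉ s → A.1 i j * B.1 j k = 0) :
    (A * B).1 i k = ∑ j ∈ s, A.1 i j * B.1 j k := by
  rw [Band.mul_apply]
  refine finsum_eq_sum_of_support_subset _ fun j hj => ?_
  by_contra hs
  exact hj (h j hs)

theorem Band.width (A : Band) : ∃ N : ℕ, ∀ i j : ℤ, (N : ℤ) < |i - j| → A.1 i j = 0 := A.2

theorem Band.eventually_mul_apply (A B : Band) (i k : ℤ) :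
    ∀ᶠ M in atTop, (A * B).1 i k = ∑ j ∈ box M, A.1 i j * B.1 j k := by
  obtain ⟨N, hN⟩ := A.width
  filter_upwards [eventually_ge_atTop (N + i.natAbs)] with M hM
  refine Band.mul_apply_eq A B i k _ fun j hj => ?_
  rw [hN i j, zero_mul]
  rcases not_mem_box hj with h | h
  · rw [abs_of_pos] <;> omega
  · rw [abs_of_neg] <;> omega

instance : NonUnitalRing Band where
  left_distrib A B D := by
    ext i k
    obtain ⟨M, h1, h2, h3⟩ := ((A.eventually_mul_apply (B + D) i k).and
      ((A.eventually_mul_apply B i k).and (A.eventually_mul_apply D i k))).exists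
    change (A * (B + D)).1 i k = (A * B).1 i k + (A * D).1 i k
    rw [h1, h2, h3, ← Finset.sum_add_distrib]
    exact Finset.sum_congr rfl fun j _ => mul_add _ _ _
  right_distrib A B D := by
    ext i k
    obtain ⟨M, h1, h2, h3⟩ := (((A + B).eventually_mul_apply D i k).and
      ((A.eventually_mul_apply D i k).and (B.eventually_mul_apply D i k))).exists
    change ((A + B) * D).1 i k = (A * D).1 i k + (B * D).1 i k
    rw [h1, h2, h3, ← Finset.sum_add_distrib]
    exact Finset.sum_congr rfl fun j _ => add_mul _ _ _
  zero_mul A := by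
    ext i k
    rw [Band.mul_apply_eq 0 A i k ∅ fun j _ => zero_mul _]
    rfl
  mul_zero A := by
    ext i k
    rw [Band.mul_apply_eq A 0 i k ∅ fun j _ => mul_zero _]
    rfl
  mul_assoc A B D := by
    ext i l
    obtain ⟨N, hN⟩ := A.width
    obtain ⟨K, hK⟩ := D.width
    set M : ℕ := N + K + i.natAbs + l.natAbs with hM
    have hA : ∀ j, j ∉ box M → A.1 i j = 0 := fun j hj => hN i j <| by
      rcases not_mem_box hj with h | h
      · rw [abs_of_pos] <;> omega
      · rw [abs_of_neg] <;> omega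
    have hD : ∀ j, j ∉ box M → D.1 j l = 0 := fun j hj => hK j l <| by
      rcases not_mem_box hj with h | h
      · rw [abs_of_neg] <;> omega
      · rw [abs_of_pos] <;> omega
    rw [Band.mul_apply_eq (A * B) D i l (box M) fun j hj => by rw [hD j hj, mul_zero],
      Band.mul_apply_eq A (B * D) i l (box M) fun j hj => by rw [hA j hj, zero_mul]]
    have h1 : ∀ k, (A * B).1 i k = ∑ j ∈ box M, A.1 i j * B.1 j k := fun k =>
      Band.mul_apply_eq A B i k (box M) fun j hj => by rw [hA j hj, zero_mul]
    have h2 : ∀ j, (B * D).1 j l = ∑ k ∈ box M, B.1 j k * D.1 k l := fun j =>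
      Band.mul_apply_eq B D j l (box M) fun k hk => by rw [hD k hk, mul_zero]
    simp only [h1, h2, Finset.sum_mul, Finset.mul_sum, mul_assoc]
    exact Finset.sum_comm

theorem J_bracket (A : Band) (i j : ℤ) : (J * A - A * J).1 i j = (ind i - ind j) * A.1 i j := by
  change (J * A).1 i j - (A * J).1 i j = _
  rw [Band.mul_apply_eq J A i j {i} fun k hk => by
      have hk : k ≠ i := by simpa using hk
      simp [J, hk.symm],
    Band.mul_apply_eq A J i j {j} fun k hk => by
      have hk : k ≠ j := by simpa using hk
      simp [J, hk]]
  simp [J, ind, sub_mul]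

theorem ind_eq_or {i j : ℤ} (h : ind i - ind j ≠ 0) : (i ≤ 0 ∧ 0 < j) ∨ (j ≤ 0 ∧ 0 < i) := by
  by_contra hc
  apply h
  unfold ind
  by_cases hi : i ≤ 0 <;> by_cases hj : j ≤ 0 <;> simp [hi, hj] <;> omega

theorem cocycle_eventually (A : Band) : ∀ᶠ M in atTop, ∀ B : Band,
    cocycle A B = ∑ i ∈ box M, ∑ j ∈ box M, (ind i - ind j) * A.1 i j * B.1 j i := by
  obtain ⟨N, hN⟩ := A.width
  filter_upwards [eventually_ge_atTop N] with M hM B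
  have key : ∀ i j, (i ∉ box M ∨ j ∉ box M) → (ind i - ind j) * A.1 i j = 0 := by
    intro i j hij
    by_cases h : ind i - ind j = 0
    · rw [h, zero_mul]
    · rw [hN i j, mul_zero]
      have := ind_eq_or h
      rcases hij with h' | h' <;> rcases not_mem_box h' with h' | h' <;>
        rcases abs_cases (i - j) with h'' | h'' <;> omega
  have h1 : ∀ i, ((J * A - A * J) * B).1 i i
      = ∑ j ∈ box M, (ind i - ind j) * A.1 i j * B.1 j i := by
    intro i
    rw [Band.mul_apply_eq _ B i i (box M)]
    · simp only [J_bracket]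
    · intro j hj
      rw [J_bracket, key i j (Or.inr hj), zero_mul]
  unfold cocycle
  simp only [h1]
  refine finsum_eq_sum_of_support_subset _ fun i hi => ?_
  by_contra hs
  exact hi (Finset.sum_eq_zero fun j _ => by rw [key i j (Or.inl hs), zero_mul])

theorem cocycle_add_left (A B D : Band) : cocycle (A + B) D = cocycle A D + cocycle B D := by
  obtain ⟨M, h1, h2, h3⟩ := ((cocycle_eventually (A + B)).and
    ((cocycle_eventually A).and (cocycle_eventually B))).exists
  rw [h1, h2, h3, ← Finset.sum_add_distrib]
  refine Finset.sum_congr rfl fun i _ => ?_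
  rw [← Finset.sum_add_distrib]
  refine Finset.sum_congr rfl fun j _ => ?_
  change (ind i - ind j) * (A.1 i j + B.1 i j) * D.1 j i = _
  ring

theorem cocycle_neg (A B : Band) : cocycle A B = - cocycle B A := by
  obtain ⟨M, h1, h2⟩ := ((cocycle_eventually A).and (cocycle_eventually B)).exists
  rw [h1, h2, Finset.sum_comm, ← Finset.sum_neg_distrib]
  refine Finset.sum_congr rfl fun i _ => ?_
  rw [← Finset.sum_neg_distrib]
  refine Finset.sum_congr rfl fun j _ => ?_
  ring

theorem cocycle_add_right (A B D : Band) : cocycle A (B + D) = cocycle A B + cocycle A D := by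
  rw [cocycle_neg A, cocycle_add_left, cocycle_neg B, cocycle_neg D]
  ring

theorem cocycle_smul_right (c : ℂ) (A B : Band) : cocycle A (c • B) = c * cocycle A B := by
  obtain ⟨M, h1⟩ := (cocycle_eventually A).exists
  rw [h1, h1, Finset.mul_sum]
  refine Finset.sum_congr rfl fun i _ => ?_
  rw [Finset.mul_sum]
  refine Finset.sum_congr rfl fun j _ => ?_
  change (ind i - ind j) * A.1 i j * (c * B.1 j i) = _
  ring

theorem cocycle_self (A : Band) : cocycle A A = 0 :=
  self_eq_neg.mp (cocycle_neg A A)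

theorem cocycle_mul_left (A B : Band) : ∀ᶠ M in atTop, ∀ D : Band,
    cocycle (A * B) D = ∑ i ∈ box M, ∑ j ∈ box M, ∑ k ∈ box M,
      (ind i - ind k) * (A.1 i j * B.1 j k * D.1 k i) := by
  obtain ⟨N, hN⟩ := A.width
  obtain ⟨K, hK⟩ := B.width
  filter_upwards [cocycle_eventually (A * B), eventually_ge_atTop (N + K)] with M hM hNK D
  rw [hM]
  refine Finset.sum_congr rfl fun i _ => ?_
  rw [Finset.sum_comm]
  refine Finset.sum_congr rfl fun k _ => ?_
  by_cases h : ind i - ind k = 0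
  · simp [h]
  · rw [Band.mul_apply_eq A B i k (box M), Finset.mul_sum, Finset.sum_mul]
    · exact Finset.sum_congr rfl fun j _ => by ring
    · intro j hj
      have h1 := ind_eq_or h
      by_cases h2 : (N : ℤ) < |i - j|
      · rw [hN i j h2, zero_mul]
      · rw [hK j k, mul_zero]
        rcases not_mem_box hj with h' | h' <;> rcases abs_cases (i - j) with h'' | h'' <;>
          rcases abs_cases (j - k) with h3 | h3 <;> omega

theorem cocycle_mul_right (A B D : Band) : ∀ᶠ M in atTop,
    cocycle A (B * D) = ∑ i ∈ box M, ∑ j ∈ box M, ∑ k ∈ box M,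
      (ind i - ind j) * (A.1 i j * B.1 j k * D.1 k i) := by
  filter_upwards [cocycle_mul_left B D] with M hM
  rw [cocycle_neg, hM, Finset.sum_comm_cycle, ← Finset.sum_neg_distrib]
  refine Finset.sum_congr rfl fun i _ => ?_
  rw [← Finset.sum_neg_distrib]
  refine Finset.sum_congr rfl fun j _ => ?_
  rw [← Finset.sum_neg_distrib]
  refine Finset.sum_congr rfl fun k _ => ?_
  ring

theorem cocycle_sub_left (A B D : Band) : cocycle (A - B) D = cocycle A D - cocycle B D := by
  have := cocycle_add_left (A - B) B D
  rw [sub_add_cancel] at this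
  rw [this]; ring

theorem cocycle_sub_right (A B D : Band) : cocycle A (B - D) = cocycle A B - cocycle A D := by
  have := cocycle_add_right A (B - D) D
  rw [sub_add_cancel] at this
  rw [this]; ring

theorem cocycle_leibniz (A B D : Band) :
    cocycle A (B * D - D * B)
      = cocycle (A * B - B * A) D + cocycle B (A * D - D * A) := by
  obtain ⟨M, h1, h2, h3, h4, h5, h6⟩ := ((cocycle_mul_right A B D).and
    ((cocycle_mul_right A D B).and ((cocycle_mul_left A B).and
    ((cocycle_mul_left B A).and ((cocycle_mul_right B A D).and
    (cocycle_mul_right B D A)))))).exists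
  simp only [cocycle_sub_left, cocycle_sub_right]
  rw [h1, h2, h3, h4, h5, h6]
  have e1 : ∑ i ∈ box M, ∑ j ∈ box M, ∑ k ∈ box M,
      (ind i - ind j) * (A.1 i j * D.1 j k * B.1 k i)
      = ∑ i ∈ box M, ∑ j ∈ box M, ∑ k ∈ box M,
      (ind j - ind k) * (B.1 i j * A.1 j k * D.1 k i) := by
    rw [Finset.sum_comm_cycle]
    exact Finset.sum_congr rfl fun i _ => Finset.sum_congr rfl fun j _ =>
      Finset.sum_congr rfl fun k _ => by ring
  have e2 : ∑ i ∈ box M, ∑ j ∈ box M, ∑ k ∈ box M,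
      (ind i - ind j) * (B.1 i j * D.1 j k * A.1 k i)
      = ∑ i ∈ box M, ∑ j ∈ box M, ∑ k ∈ box M,
      (ind j - ind k) * (A.1 i j * B.1 j k * D.1 k i) := by
    rw [Finset.sum_comm_cycle]
    exact Finset.sum_congr rfl fun i _ => Finset.sum_congr rfl fun j _ =>
      Finset.sum_congr rfl fun k _ => by ring
  rw [e1, e2]
  simp only [← Finset.sum_add_distrib, ← Finset.sum_sub_distrib]
  exact Finset.sum_congr rfl fun i _ => Finset.sum_congr rfl fun j _ =>
    Finset.sum_congr rfl fun k _ => by ring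

/-- The Lie algebra `a_∞`: the central extension `\bar a_∞ ⊕ ℂ c` of the Lie algebra of band
matrices. A pair `(A, s)` stands for `A + s c`. -/
def AInf : Type := Band × ℂ

namespace AInf

instance : AddCommGroup AInf := inferInstanceAs (AddCommGroup (Band × ℂ))

instance : Module ℂ AInf := inferInstanceAs (Module ℂ (Band × ℂ))

/-- The matrix part `A` of `A + s c`. -/
def mat : AInf →ₗ[ℂ] Band := LinearMap.fst ℂ Band ℂ

/-- The coefficient `s` of the central element in `A + s c`. -/
def cen : AInf →ₗ[ℂ] ℂ := LinearMap.snd ℂ Band ℂ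

/-- The inclusion `A ↦ A` of the band matrices. -/
def ofMat : Band →ₗ[ℂ] AInf := LinearMap.inl ℂ Band ℂ

/-- The central element `c`. -/
def c : AInf := ((0 : Band), (1 : ℂ))

theorem ext' {x y : AInf} (h1 : mat x = mat y) (h2 : cen x = cen y) : x = y := Prod.ext h1 h2

/-- `[A + s c, B + t c] = (A B - B A) + C(A, B) c`. -/
instance : Bracket AInf AInf where
  bracket x y := (mat x * mat y - mat y * mat x, cocycle (mat x) (mat y))

theorem mat_lie (x y : AInf) : mat ⁅x, y⁆ = mat x * mat y - mat y * mat x := rfl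

theorem cen_lie (x y : AInf) : cen ⁅x, y⁆ = cocycle (mat x) (mat y) := rfl

instance : LieRing AInf where
  add_lie x y z := by
    refine ext' ?_ ?_
    · simp only [mat_lie, map_add]; noncomm_ring
    · simp only [cen_lie, map_add, cocycle_add_left]
  lie_add x y z := by
    refine ext' ?_ ?_
    · simp only [mat_lie, map_add]; noncomm_ring
    · simp only [cen_lie, map_add, cocycle_add_right]
  lie_self x := by
    refine ext' ?_ ?_
    · simp only [mat_lie, map_zero, sub_self]
    · simp only [cen_lie, map_zero, cocycle_self]
  leibniz_lie x y z := by
    refine ext' ?_ ?_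
    · simp only [mat_lie, map_add]; noncomm_ring
    · rw [map_add, cen_lie, cen_lie, cen_lie, mat_lie, mat_lie, mat_lie]
      exact cocycle_leibniz _ _ _

end AInf

theorem Band.mul_smul' (t : ℂ) (A B : Band) : A * (t • B) = t • (A * B) := by
  ext i k
  obtain ⟨M, h1, h2⟩ := ((A.eventually_mul_apply (t • B) i k).and
    (A.eventually_mul_apply B i k)).exists
  change _ = t * (A * B).1 i k
  rw [h1, h2, Finset.mul_sum]
  refine Finset.sum_congr rfl fun j _ => ?_
  change A.1 i j * (t * B.1 j k) = _
  ring

theorem Band.smul_mul' (t : ℂ) (A B : Band) : (t • A) * B = t • (A * B) := by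
  ext i k
  obtain ⟨M, h1, h2⟩ := (((t • A).eventually_mul_apply B i k).and
    (A.eventually_mul_apply B i k)).exists
  change _ = t * (A * B).1 i k
  rw [h1, h2, Finset.mul_sum]
  refine Finset.sum_congr rfl fun j _ => ?_
  change (t * A.1 i j) * B.1 j k = _
  ring

instance : LieAlgebra ℂ AInf where
  lie_smul t x y := by
    refine AInf.ext' ?_ ?_
    · simp only [AInf.mat_lie, map_smul, Band.mul_smul', Band.smul_mul', smul_sub]
    · simp only [AInf.cen_lie, map_smul, cocycle_smul_right, smul_eq_mul]

/-! ### Highest weight modules over `a_∞` -/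

/-- `a_∞^+`: the strictly upper triangular matrices. -/
def upper : Submodule ℂ AInf where
  carrier := {x | AInf.cen x = 0 ∧ ∀ i j : ℤ, j ≤ i → (AInf.mat x).1 i j = 0}
  zero_mem' := ⟨rfl, fun _ _ _ => rfl⟩
  add_mem' := by
    rintro x y ⟨hx, hx'⟩ ⟨hy, hy'⟩
    refine ⟨by rw [map_add, hx, hy, add_zero], fun i j h => ?_⟩
    change (AInf.mat x).1 i j + (AInf.mat y).1 i j = 0
    rw [hx' i j h, hy' i j h, add_zero]
  smul_mem' := by
    rintro t x ⟨hx, hx'⟩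
    refine ⟨by rw [map_smul, hx, smul_zero], fun i j h => ?_⟩
    change t * (AInf.mat x).1 i j = 0
    rw [hx' i j h, mul_zero]

/-- `a_∞^0 = gl_0 ⊕ ℂ c`, where `gl_0` consists of the diagonal matrices. -/
def cartan : Submodule ℂ AInf where
  carrier := {x | ∀ i j : ℤ, i ≠ j → (AInf.mat x).1 i j = 0}
  zero_mem' := fun _ _ _ => rfl
  add_mem' := by
    intro x y hx hy i j h
    change (AInf.mat x).1 i j + (AInf.mat y).1 i j = 0
    rw [hx i j h, hy i j h, add_zero]
  smul_mem' := by
    intro t x hx i j h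
    change t * (AInf.mat x).1 i j = 0
    rw [hx i j h, mul_zero]

/-- The linear functional `D + s c ↦ d_i` on `a_∞^0`, for `D = diag(d_i)`. -/
def diagEntry (i : ℤ) : Module.Dual ℂ cartan where
  toFun h := (AInf.mat h.1).1 i i
  map_add' _ _ := rfl
  map_smul' _ _ := rfl

/-- The weight `Λ_n`, with `Λ_n(E_{ii}) = 1` for `0 < i ≤ n`, `Λ_n(E_{ii}) = -1` for `n < i ≤ 0`,
`Λ_n(E_{ii}) = 0` otherwise, and `Λ_n(c) = 0`; on a diagonal matrix with infinitely many nonzero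
entries it is the finite sum `∑_{0 < i ≤ n} d_i - ∑_{n < i ≤ 0} d_i`. -/
def weight (n : ℤ) : Module.Dual ℂ cartan :=
  ∑ i ∈ Finset.Ioc 0 n, diagEntry i - ∑ i ∈ Finset.Ioc n 0, diagEntry i

/-- The weight with value `1` on `c` and `0` on all diagonal matrices. -/
def weightHatZero : Module.Dual ℂ cartan where
  toFun h := AInf.cen h.1
  map_add' _ _ := map_add _ _ _
  map_smul' _ _ := map_smul _ _ _

/-- The `n`-th fundamental weight. -/
def weightHat (n : ℤ) : Module.Dual ℂ cartan := weight n + weightHatZero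

/-- The universal enveloping algebra of `a_∞`. -/
abbrev UAInf : Type := UniversalEnvelopingAlgebra ℂ AInf

/-- The left ideal of `U(a_∞)` generated by `a_∞^+` and the elements `h - Λ(h)`, `h ∈ a_∞^0`. -/
def vermaIdeal (Λ : Module.Dual ℂ cartan) : Submodule UAInf UAInf :=
  Submodule.span UAInf
    ({u | ∃ x ∈ upper, u = UniversalEnvelopingAlgebra.ι ℂ x} ∪
      {u | ∃ h : cartan, u = UniversalEnvelopingAlgebra.ι ℂ h.1 - algebraMap ℂ UAInf (Λ h)})

/-- The Verma module of `a_∞` with highest weight `Λ` (and central charge `Λ(c)`). -/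
abbrev Verma (Λ : Module.Dual ℂ cartan) : Type := UAInf ⧸ vermaIdeal Λ

/-- The irreducible highest weight module `L(a_∞; Λ, Λ(c))`: the quotient of the Verma module by the
sum of its proper submodules. -/
def Irr (Λ : Module.Dual ℂ cartan) : Type :=
  Verma Λ ⧸ sSup {N : Submodule UAInf (Verma Λ) | N ≠ ⊤}

namespace Irr

variable (Λ : Module.Dual ℂ cartan)

instance : AddCommGroup (Irr Λ) :=
  inferInstanceAs (AddCommGroup (Verma Λ ⧸ sSup {N : Submodule UAInf (Verma Λ) | N ≠ ⊤}))

instance : Module UAInf (Irr Λ) :=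
  inferInstanceAs (Module UAInf (Verma Λ ⧸ sSup {N : Submodule UAInf (Verma Λ) | N ≠ ⊤}))

instance : Module ℂ (Irr Λ) :=
  inferInstanceAs (Module ℂ (Verma Λ ⧸ sSup {N : Submodule UAInf (Verma Λ) | N ≠ ⊤}))

instance : IsScalarTower ℂ UAInf (Irr Λ) :=
  inferInstanceAs (IsScalarTower ℂ UAInf
    (Verma Λ ⧸ sSup {N : Submodule UAInf (Verma Λ) | N ≠ ⊤}))

/-- `x ∈ a_∞` acts as its image in `U(a_∞)`. -/
instance : LieRingModule AInf (Irr Λ) where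
  bracket x v := UniversalEnvelopingAlgebra.ι ℂ x • v
  add_lie x y v := by
    change UniversalEnvelopingAlgebra.ι ℂ (x + y) • v = _
    rw [map_add, add_smul]
  lie_add x v w := smul_add _ _ _
  leibniz_lie x y v := by
    let _ : LieRing UAInf := LieRing.ofAssociativeRing
    change UniversalEnvelopingAlgebra.ι ℂ x • UniversalEnvelopingAlgebra.ι ℂ y • v
      = UniversalEnvelopingAlgebra.ι ℂ ⁅x, y⁆ • v
        + UniversalEnvelopingAlgebra.ι ℂ y • UniversalEnvelopingAlgebra.ι ℂ x • v
    rw [LieHom.map_lie, LieRing.of_associative_ring_bracket, sub_smul, mul_smul, mul_smul,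
      sub_add_cancel]

instance : LieModule ℂ AInf (Irr Λ) where
  smul_lie t x v := by
    change UniversalEnvelopingAlgebra.ι ℂ (t • x) • v = t • UniversalEnvelopingAlgebra.ι ℂ x • v
    rw [map_smul, smul_assoc]
  lie_smul t x v := by
    change UniversalEnvelopingAlgebra.ι ℂ x • t • v = t • UniversalEnvelopingAlgebra.ι ℂ x • v
    rw [← algebraMap_smul UAInf t v, ← algebraMap_smul UAInf t
      (UniversalEnvelopingAlgebra.ι ℂ x • v), ← mul_smul, ← mul_smul, Algebra.commutes]

end Irr

/-! ### The action of `a_∞` by normally ordered quadratic expressions in fermions -/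

/-- Operators `a_i` and `b_j` (`i, j : ℤ`) with `{a_i, b_j} = δ_{ij}`, `{a_i, a_j} = {b_i, b_j} = 0`,
such that every vector is annihilated by `b_j` for `j ≫ 0` and by `a_i` for `i ≪ 0`. The two Fock
spaces below are shown to carry such operators. -/
structure FermionPair (F : Type) [AddCommGroup F] [Module ℂ F] where
  a : ℤ → Module.End ℂ F
  b : ℤ → Module.End ℂ F
  ab : ∀ i j, a i * b j + b j * a i = if i = j then 1 else 0
  aa : ∀ i j, a i * a j + a j * a i = 0
  bb : ∀ i j, b i * b j + b j * b i = 0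
  fin : ∀ v : F, ∃ N : ℕ, (∀ j : ℤ, (N : ℤ) < j → b j v = 0) ∧ ∀ i : ℤ, i < -(N : ℤ) → a i v = 0

namespace FermionPair

variable {F : Type} [AddCommGroup F] [Module ℂ F] (m : FermionPair F)

/-- The normal ordered product `:a_i b_j:`. -/
def nop (i j : ℤ) : Module.End ℂ F :=
  if i = j ∧ i ≤ 0 then -(m.b j * m.a i) else m.a i * m.b j

theorem nop_eq (i j : ℤ) : m.nop i j = m.a i * m.b j - (if i = j then ind i else 0) • 1 := by
  unfold nop ind
  have h := m.ab i j
  by_cases hij : i = j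
  · by_cases hi : i ≤ 0
    · rw [if_pos ⟨hij, hi⟩, if_pos hij, if_pos hi, one_smul]
      rw [if_pos hij] at h
      rw [← h]
      abel
    · rw [if_neg fun hc => hi hc.2, if_pos hij, if_neg hi, zero_smul, sub_zero]
  · rw [if_neg fun hc => hij hc.1, if_neg hij, zero_smul, sub_zero]

theorem fin_nop (v : F) : ∃ N : ℕ, ∀ i j : ℤ, (i < -(N : ℤ) ∨ (N : ℤ) < j) → m.nop i j v = 0 := by
  obtain ⟨N, hb, ha⟩ := m.fin v
  refine ⟨N, fun i j hij => ?_⟩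
  unfold nop
  split_ifs with h
  · rw [LinearMap.neg_apply, Module.End.mul_apply]
    rw [ha i (by omega), map_zero, neg_zero]
  · rcases hij with hi | hj
    · have h2 : i ≠ j := fun hc => h ⟨hc, by omega⟩
      have h3 := LinearMap.congr_fun (m.ab i j) v
      rw [if_neg h2, LinearMap.add_apply, Module.End.mul_apply, Module.End.mul_apply, ha i hi,
        map_zero, add_zero] at h3
      exact h3
    · rw [Module.End.mul_apply, hb j hj, map_zero]

theorem a_comm (i j : ℤ) : m.a i * m.a j = -(m.a j * m.a i) := eq_neg_of_add_eq_zero_left (m.aa i j)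

theorem b_comm (i j : ℤ) : m.b i * m.b j = -(m.b j * m.b i) := eq_neg_of_add_eq_zero_left (m.bb i j)

theorem b_a (i j : ℤ) : m.b j * m.a i = (if i = j then (1 : ℂ) else 0) • 1 - m.a i * m.b j := by
  rw [eq_sub_iff_add_eq, add_comm, m.ab i j]
  split_ifs <;> simp

theorem quad (i j k l : ℤ) : (m.a i * m.b j) * (m.a k * m.b l)
    = (if k = j then (1 : ℂ) else 0) • (m.a i * m.b l) - m.a i * m.a k * (m.b j * m.b l) := by
  have : (m.a i * m.b j) * (m.a k * m.b l) = m.a i * (m.b j * m.a k) * m.b l := by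
    noncomm_ring
  rw [this, m.b_a, mul_sub, sub_mul, mul_smul_comm, smul_mul_assoc, mul_one]
  noncomm_ring

theorem nop_comm (i j k l : ℤ) : m.nop i j * m.nop k l - m.nop k l * m.nop i j
    = (if k = j then (1 : ℂ) else 0) • m.nop i l - (if i = l then (1 : ℂ) else 0) • m.nop k j
      + (if k = j then (if i = l then ind i - ind j else 0) else 0) • 1 := by
  have h0 : m.nop i j * m.nop k l - m.nop k l * m.nop i j
      = (m.a i * m.b j) * (m.a k * m.b l) - (m.a k * m.b l) * (m.a i * m.b j) := by
    simp only [nop_eq, mul_sub, sub_mul, mul_smul_comm, smul_mul_assoc, mul_one, one_mul]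
    module
  have h1 : m.a i * m.a k * (m.b j * m.b l) = m.a k * m.a i * (m.b l * m.b j) := by
    rw [m.a_comm i k, m.b_comm j l, neg_mul_neg]
  rw [h0, quad, quad, h1, nop_eq, nop_eq]
  by_cases h2 : k = j <;> by_cases h3 : i = l <;> simp [h2, h3, sub_smul] <;> abel

/-- The action of a band matrix: `A ↦ ∑_{i,j} a_{ij} :a_i b_j:`, where on each vector only finitely
many terms are nonzero. -/
def act (A : Band) (v : F) : F := ∑ᶠ p : ℤ × ℤ, A.1 p.1 p.2 • m.nop p.1 p.2 v

theorem act_eventually (A : Band) (v : F) : ∀ᶠ M in atTop,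
    m.act A v = ∑ i ∈ box M, ∑ j ∈ box M, A.1 i j • m.nop i j v := by
  obtain ⟨N, hN⟩ := m.fin_nop v
  obtain ⟨K, hK⟩ := A.width
  filter_upwards [eventually_ge_atTop (N + K)] with M hM
  rw [← Finset.sum_product']
  refine finsum_eq_sum_of_support_subset _ fun p hp => ?_
  by_contra hs
  apply hp
  change A.1 p.1 p.2 • m.nop p.1 p.2 v = 0
  by_cases h1 : (K : ℤ) < |p.1 - p.2|
  · rw [hK _ _ h1, zero_smul]
  · rw [hN, smul_zero]
    by_contra hc
    apply hs
    rw [Finset.mem_coe, Finset.mem_product, Finset.mem_Icc, Finset.mem_Icc]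
    rcases abs_cases (p.1 - p.2) with h | h <;> omega

theorem act_add_left (A B : Band) (v : F) : m.act (A + B) v = m.act A v + m.act B v := by
  obtain ⟨M, h1, h2, h3⟩ := ((m.act_eventually (A + B) v).and
    ((m.act_eventually A v).and (m.act_eventually B v))).exists
  rw [h1, h2, h3]
  simp only [← Finset.sum_add_distrib]
  exact Finset.sum_congr rfl fun i _ => Finset.sum_congr rfl fun j _ => add_smul _ _ _

theorem act_smul_left (t : ℂ) (A : Band) (v : F) : m.act (t • A) v = t • m.act A v := by
  obtain ⟨M, h1, h2⟩ := ((m.act_eventually (t • A) v).and (m.act_eventually A v)).exists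
  rw [h1, h2]
  simp only [Finset.smul_sum]
  exact Finset.sum_congr rfl fun i _ => Finset.sum_congr rfl fun j _ => mul_smul _ _ _

theorem act_add_right (A : Band) (v w : F) : m.act A (v + w) = m.act A v + m.act A w := by
  obtain ⟨M, h1, h2, h3⟩ := ((m.act_eventually A (v + w)).and
    ((m.act_eventually A v).and (m.act_eventually A w))).exists
  rw [h1, h2, h3]
  simp only [← Finset.sum_add_distrib, map_add, smul_add]

theorem act_smul_right (t : ℂ) (A : Band) (v : F) : m.act A (t • v) = t • m.act A v := by
  obtain ⟨M, h1, h2⟩ := ((m.act_eventually A (t • v)).and (m.act_eventually A v)).exists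
  rw [h1, h2]
  simp only [Finset.smul_sum, map_smul]
  exact Finset.sum_congr rfl fun i _ => Finset.sum_congr rfl fun j _ => smul_comm _ _ _

theorem act_sub_left (A B : Band) (v : F) : m.act (A - B) v = m.act A v - m.act B v := by
  have := m.act_add_left (A - B) B v
  rw [sub_add_cancel] at this
  rw [this, add_sub_cancel_right]

theorem act_mul_eventually (A B : Band) (v : F) : ∀ᶠ M in atTop,
    m.act (A * B) v
      = ∑ i ∈ box M, ∑ l ∈ box M, ∑ j ∈ box M, (A.1 i j * B.1 j l) • m.nop i l v := by
  obtain ⟨N, hN⟩ := m.fin_nop v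
  obtain ⟨K, hK⟩ := A.width
  obtain ⟨K', hK'⟩ := B.width
  filter_upwards [m.act_eventually (A * B) v, eventually_ge_atTop (N + K + K')] with M h1 hM
  rw [h1]
  refine Finset.sum_congr rfl fun i _ => Finset.sum_congr rfl fun l _ => ?_
  rw [← Finset.sum_smul]
  by_cases h : i < -(N : ℤ) ∨ (N : ℤ) < l
  · rw [hN i l h, smul_zero, smul_zero]
  · rw [Band.mul_apply_eq A B i l (box M)]
    intro j hj
    by_cases h2 : (K : ℤ) < |i - j|
    · rw [hK i j h2, zero_mul]
    · rw [hK' j l, mul_zero]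
      rcases not_mem_box hj with h' | h' <;> rcases abs_cases (i - j) with h3 | h3 <;>
        rcases abs_cases (j - l) with h4 | h4 <;> omega

/-- The operators `:a_i b_j:` represent `a_∞` with central charge `1`. -/
theorem act_comm (A B : Band) (v : F) : m.act A (m.act B v) - m.act B (m.act A v)
    = m.act (A * B - B * A) v + cocycle A B • v := by
  obtain ⟨M, h1, h2, h3, h4, h5, h6, h7⟩ := ((m.act_eventually A v).and
    ((m.act_eventually B v).and ((m.act_eventually A (m.act B v)).and
    ((m.act_eventually B (m.act A v)).and ((m.act_mul_eventually A B v).and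
    ((m.act_mul_eventually B A v).and (cocycle_eventually A))))))).exists
  have e1 : m.act A (m.act B v) = ∑ i ∈ box M, ∑ j ∈ box M, ∑ k ∈ box M, ∑ l ∈ box M,
      (A.1 i j * B.1 k l) • (m.nop i j * m.nop k l) v := by
    rw [h3, h2]
    simp only [map_sum, map_smul, Finset.smul_sum, mul_smul, Module.End.mul_apply]
  have e2 : m.act B (m.act A v) = ∑ i ∈ box M, ∑ j ∈ box M, ∑ k ∈ box M, ∑ l ∈ box M,
      (A.1 i j * B.1 k l) • (m.nop k l * m.nop i j) v := by
    rw [h4, h1]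
    simp only [map_sum, map_smul, Finset.smul_sum, Module.End.mul_apply, smul_smul]
    simp only [← Finset.sum_product' (box M) (box M)]
    rw [Finset.sum_comm]
    exact Finset.sum_congr rfl fun p _ => Finset.sum_congr rfl fun q _ => by rw [mul_comm]
  have e3 : ∀ i j k l : ℤ, (A.1 i j * B.1 k l) • (m.nop i j * m.nop k l) v
      - (A.1 i j * B.1 k l) • (m.nop k l * m.nop i j) v
      = (if k = j then (A.1 i j * B.1 k l) • m.nop i l v else 0)
        - (if i = l then (A.1 i j * B.1 k l) • m.nop k j v else 0)
        + (if k = j then if i = l then ((ind i - ind j) * A.1 i j * B.1 k l) • v else 0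
            else 0) := by
    intro i j k l
    rw [← smul_sub, ← LinearMap.sub_apply, m.nop_comm]
    by_cases hk : k = j <;> by_cases hl : i = l <;> simp [hk, hl]
    module
  rw [e1, e2, act_sub_left, h5, h6, h7]
  simp only [← Finset.sum_sub_distrib, e3]
  simp only [Finset.sum_sub_distrib, Finset.sum_add_distrib, Finset.sum_smul]
  congr 1
  · congr 1
    · refine Finset.sum_congr rfl fun i _ => ?_
      rw [Finset.sum_comm (s := box M) (t := box M)
        (f := fun l j => (A.1 i j * B.1 j l) • m.nop i l v)]
      refine Finset.sum_congr rfl fun j hj => ?_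
      rw [Finset.sum_comm]
      refine Finset.sum_congr rfl fun l _ => ?_
      rw [Finset.sum_ite_eq' (box M) j, if_pos hj]
    · rw [Finset.sum_congr rfl fun i hi => Finset.sum_congr rfl fun j _ =>
        Finset.sum_congr rfl fun k _ => by
          rw [Finset.sum_ite_eq (box M) i, if_pos hi]]
      rw [Finset.sum_comm_cycle]
      refine Finset.sum_congr rfl fun k _ => ?_
      rw [Finset.sum_comm]
      exact Finset.sum_congr rfl fun j _ => Finset.sum_congr rfl fun i _ => by rw [mul_comm]
  · refine Finset.sum_congr rfl fun i hi => Finset.sum_congr rfl fun j hj => ?_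
    rw [Finset.sum_comm]
    rw [Finset.sum_congr rfl fun l _ => by rw [Finset.sum_ite_eq' (box M) j, if_pos hj]]
    rw [Finset.sum_ite_eq (box M) i, if_pos hi]

/-- A central charge `1` representation of `a_∞`: `E_{ij} ↦ :a_i b_j:` and `c ↦ 1`. -/
@[reducible] def lieRingModule : LieRingModule AInf F where
  bracket x v := m.act (AInf.mat x) v + AInf.cen x • v
  add_lie x y v := by
    rw [map_add, map_add, act_add_left, add_smul]
    abel
  lie_add x v w := by
    rw [act_add_right, smul_add]
    abel
  leibniz_lie x y v := by
    rw [AInf.mat_lie, AInf.cen_lie]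
    have h := m.act_comm (AInf.mat x) (AInf.mat y) v
    simp only [act_add_right, act_smul_right, smul_add]
    rw [sub_eq_iff_eq_add] at h
    rw [h, smul_comm (AInf.cen x) (AInf.cen y)]
    abel

theorem lieModule : @LieModule ℂ AInf F _ _ _ _ _ m.lieRingModule := by
  let _ : LieRingModule AInf F := m.lieRingModule
  refine ⟨fun t x v => ?_, fun t x v => ?_⟩
  · change m.act (AInf.mat (t • x)) v + AInf.cen (t • x) • v
      = t • (m.act (AInf.mat x) v + AInf.cen x • v)
    rw [map_smul, map_smul, act_smul_left, smul_assoc, smul_add]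
  · change m.act (AInf.mat x) (t • v) + AInf.cen x • t • v
      = t • (m.act (AInf.mat x) v + AInf.cen x • v)
    rw [act_smul_right, smul_comm, smul_add]

/-- `E_{ij}` acts as `:a_i b_j:`. -/
theorem act_E (i j : ℤ) (v : F) : m.act (E i j) v = m.nop i j v := by
  unfold act
  rw [finsum_eq_single _ (i, j)]
  · change (if i = i ∧ j = j then (1 : ℂ) else 0) • m.nop i j v = _
    rw [if_pos ⟨rfl, rfl⟩, one_smul]
  · rintro ⟨k, l⟩ h
    change (if k = i ∧ l = j then (1 : ℂ) else 0) • m.nop k l v = 0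
    rw [if_neg fun hc => h (Prod.ext hc.1 hc.2), zero_smul]

end FermionPair

/-! ### Clifford algebras and Fock spaces -/

section Fock

variable {X : Type} (β : X → X → ℂ)

/-- The quadratic form on the space with basis `X` for which the generators of the Clifford algebra
satisfy `x y + y x = β(x, y)`, for symmetric `β`. -/
def cliffForm : QuadraticForm ℂ (X →₀ ℂ) :=
  (1 / 2 : ℂ) • LinearMap.BilinMap.toQuadraticMap
    (Finsupp.linearCombination ℂ fun x => Finsupp.linearCombination ℂ (β x))

/-- The Clifford algebra with generators `x : X` and relations `x y + y x = β(x, y)`. -/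
abbrev Cliff : Type := CliffordAlgebra (cliffForm β)

/-- The generators. -/
def gen (x : X) : Cliff β := CliffordAlgebra.ι (cliffForm β) (Finsupp.single x 1)

theorem gen_anticomm (hβ : ∀ x y, β x y = β y x) (x y : X) :
    gen β x * gen β y + gen β y * gen β x = algebraMap ℂ (Cliff β) (β x y) := by
  unfold gen
  rw [CliffordAlgebra.ι_mul_ι_add_swap]
  congr 1
  unfold cliffForm
  rw [FunLike.coe_smul, QuadraticMap.polar_smul, LinearMap.BilinMap.polar_toQuadraticMap]
  simp [hβ y x]
  ring

/-- The left ideal generated by the annihilation operators `x ∈ P`. -/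
abbrev vacIdeal (P : Set X) : Submodule (Cliff β) (Cliff β) :=
  Submodule.span (Cliff β) (gen β '' P)

/-- The highest weight module of the Clifford algebra generated by a vacuum vector `|0⟩` with the
relations `x |0⟩ = 0` for `x ∈ P`. -/
def Fock (P : Set X) : Type := Cliff β ⧸ vacIdeal β P

variable (P : Set X)

instance : AddCommGroup (Fock β P) := inferInstanceAs (AddCommGroup (Cliff β ⧸ vacIdeal β P))

instance : Module (Cliff β) (Fock β P) :=
  inferInstanceAs (Module (Cliff β) (Cliff β ⧸ vacIdeal β P))

instance : Module ℂ (Fock β P) := inferInstanceAs (Module ℂ (Cliff β ⧸ vacIdeal β P))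

instance : IsScalarTower ℂ (Cliff β) (Fock β P) :=
  inferInstanceAs (IsScalarTower ℂ (Cliff β) (Cliff β ⧸ vacIdeal β P))

/-- The vacuum vector `|0⟩`. -/
def vac : Fock β P := Submodule.Quotient.mk (p := vacIdeal β P) 1

/-- The operator on the Fock space given by a generator of the Clifford algebra. -/
def op (x : X) : Module.End ℂ (Fock β P) := Algebra.lsmul ℂ ℂ (Fock β P) (gen β x)

theorem op_anticomm (hβ : ∀ x y, β x y = β y x) (x y : X) :
    op β P x * op β P y + op β P y * op β P x = β x y • 1 := by
  unfold op
  rw [← map_mul, ← map_mul, ← map_add, gen_anticomm β hβ, AlgHom.commutes,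
    Algebra.algebraMap_eq_smul_one]

theorem op_vac {x : X} (hx : x ∈ P) : op β P x (vac β P) = 0 := by
  change Submodule.Quotient.mk (p := vacIdeal β P) (gen β x • 1) = 0
  rw [Submodule.Quotient.mk_eq_zero, smul_eq_mul, mul_one]
  exact Submodule.subset_span ⟨x, hx, rfl⟩

theorem fock_induction {p : Fock β P → Prop} (h0 : p 0) (hv : p (vac β P))
    (ha : ∀ v w, p v → p w → p (v + w)) (hs : ∀ (t : ℂ) v, p v → p (t • v))
    (ho : ∀ x v, p v → p (op β P x v)) (v : Fock β P) : p v := by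
  obtain ⟨u, rfl⟩ := Submodule.Quotient.mk_surjective (vacIdeal β P) v
  induction u using CliffordAlgebra.left_induction with
  | algebraMap r =>
    rw [Algebra.algebraMap_eq_smul_one]
    exact hs r _ hv
  | add x y hx hy => exact ha _ _ hx hy
  | ι_mul u f hu =>
    induction f using Finsupp.induction_linear with
    | zero =>
      rw [map_zero, zero_mul]
      exact h0
    | add f g hf hg =>
      rw [map_add, add_mul]
      exact ha _ _ hf hg
    | single x t =>
      have : CliffordAlgebra.ι (cliffForm β) (Finsupp.single x t) = t • gen β x := by
        rw [gen, ← map_smul, Finsupp.smul_single, smul_eq_mul, mul_one]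
      rw [this, smul_mul_assoc]
      exact hs t _ (ho x _ hu)

variable {β P}

/-- Creation and annihilation operators `a_i = α(i)`, `b_j = γ(j)` on a Fock space. -/
def Fock.pair (hβ : ∀ x y, β x y = β y x) (α γ : ℤ → X)
    (hαγ : ∀ i j, β (α i) (γ j) = if i = j then 1 else 0)
    (hαα : ∀ i j, β (α i) (α j) = 0) (hγγ : ∀ i j, β (γ i) (γ j) = 0)
    (hα : ∀ i ≤ 0, α i ∈ P) (hγ : ∀ j > 0, γ j ∈ P)
    (hX : ∀ x, (∃ i, x = α i) ∨ ∃ j, x = γ j) : FermionPair (Fock β P) where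
  a i := op β P (α i)
  b j := op β P (γ j)
  ab i j := by
    rw [op_anticomm β P hβ, hαγ]
    split_ifs <;> simp
  aa i j := by rw [op_anticomm β P hβ, hαα, zero_smul]
  bb i j := by rw [op_anticomm β P hβ, hγγ, zero_smul]
  fin v := by
    have key : ∀ x y v, op β P x v = 0 → β x y = 0 → op β P x (op β P y v) = 0 := by
      intro x y v h1 h2
      have h := LinearMap.congr_fun (op_anticomm β P hβ x y) v
      rw [h2, zero_smul, LinearMap.add_apply, Module.End.mul_apply, Module.End.mul_apply, h1,
        map_zero, add_zero] at h
      exact h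
    induction v using fock_induction with
    | h0 => exact ⟨0, fun j _ => map_zero _, fun i _ => map_zero _⟩
    | hv =>
      exact ⟨0, fun j hj => op_vac β P (hγ j (by simpa using hj)),
        fun i hi => op_vac β P (hα i (by simp at hi; omega))⟩
    | ha v w hv hw =>
      obtain ⟨N, h1, h2⟩ := hv
      obtain ⟨M, h3, h4⟩ := hw
      refine ⟨N + M, fun j hj => ?_, fun i hi => ?_⟩
      · rw [map_add, h1 j (by omega), h3 j (by omega), add_zero]
      · rw [map_add, h2 i (by omega), h4 i (by omega), add_zero]
    | hs t v hv =>
      obtain ⟨N, h1, h2⟩ := hv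
      refine ⟨N, fun j hj => ?_, fun i hi => ?_⟩
      · rw [map_smul, h1 j hj, smul_zero]
      · rw [map_smul, h2 i hi, smul_zero]
    | ho x v hv =>
      obtain ⟨N, h1, h2⟩ := hv
      rcases hX x with ⟨k, rfl⟩ | ⟨k, rfl⟩
      · refine ⟨N + k.natAbs, fun j hj => ?_, fun i hi => ?_⟩
        · exact key _ _ _ (h1 j (by omega)) (by rw [hβ, hαγ, if_neg (by omega)])
        · exact key _ _ _ (h2 i (by omega)) (hαα _ _)
      · refine ⟨N + k.natAbs, fun j hj => ?_, fun i hi => ?_⟩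
        · exact key _ _ _ (h1 j (by omega)) (hγγ _ _)
        · exact key _ _ _ (h2 i (by omega)) (by rw [hαγ, if_neg (by omega)])

end Fock

/-! ### The Fock space of a single neutral fermion -/

/-- `{φ_{k - 1/2}, φ_{l - 1/2}} = δ_{k + l, 1}`; the integer `k` stands for the mode
`φ_{k - 1/2}`. -/
def neutralForm (k l : ℤ) : ℂ := if k + l = 1 then 1 else 0

/-- The Fock space `F^{⊗ 1/2}` of a single neutral fermion: the vacuum is annihilated by the modes
`φ_{k - 1/2}` with `k - 1/2 > 0`. -/
def NeutralFock : Type := Fock neutralForm {k : ℤ | 1 ≤ k}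

namespace NeutralFock

instance : AddCommGroup NeutralFock := inferInstanceAs (AddCommGroup (Fock _ _))

instance : Module ℂ NeutralFock := inferInstanceAs (Module ℂ (Fock _ _))

/-- The vacuum vector. -/
def vacuum : NeutralFock := vac _ _

/-- The operator `φ_{k - 1/2}`. -/
def phi (k : ℤ) : Module.End ℂ NeutralFock := op neutralForm {k : ℤ | 1 ≤ k} k

/-- The operators `a_i = φ_{-2i + 1/2}` and `b_j = φ_{2j - 1/2}`. -/
def pair : FermionPair NeutralFock :=
  Fock.pair (β := neutralForm) (P := {k : ℤ | 1 ≤ k})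
    (fun k l => by simp only [neutralForm, add_comm])
    (fun i => -2 * i + 1) (fun j => 2 * j)
    (fun i j => if_congr (by omega) rfl rfl)
    (fun i j => if_neg (by omega)) (fun i j => if_neg (by omega))
    (fun i hi => by change 1 ≤ -2 * i + 1; omega)
    (fun j hj => by change 1 ≤ 2 * j; omega)
    (fun x => by
      rcases Int.even_or_odd' x with ⟨k, hk | hk⟩
      · exact Or.inr ⟨k, hk⟩
      · exact Or.inl ⟨-k, by omega⟩)

theorem pair_a (i : ℤ) : pair.a i = phi (-2 * i + 1) := rfl

theorem pair_b (j : ℤ) : pair.b j = phi (2 * j) := rfl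

/-- The representation `r_1` of `a_∞`: `E_{ij} ↦ :φ_{-2i + 1/2} φ_{2j - 1/2}:`, `c ↦ 1`. -/
instance : LieRingModule AInf NeutralFock := pair.lieRingModule

instance : LieModule ℂ AInf NeutralFock := pair.lieModule

theorem lie_eq (x : AInf) (v : NeutralFock) :
    ⁅x, v⁆ = pair.act (AInf.mat x) v + AInf.cen x • v := rfl

theorem phi_anticomm (k l : ℤ) : phi k * phi l + phi l * phi k = neutralForm k l • 1 :=
  op_anticomm neutralForm {k : ℤ | 1 ≤ k} (fun k l => by simp only [neutralForm, add_comm]) k l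

theorem phi_vacuum {k : ℤ} (hk : 1 ≤ k) : phi k vacuum = 0 := op_vac neutralForm {k : ℤ | 1 ≤ k} hk

/-- The monomial `φ_{k_1 - 1/2} ⋯ φ_{k_r - 1/2} |0⟩`. -/
def word (l : List ℤ) : NeutralFock := (l.map phi).prod vacuum

/-- The lists `k_1 < ⋯ < k_r ≤ 0`; the corresponding monomials
`φ_{k_1 - 1/2} ⋯ φ_{k_r - 1/2} |0⟩` form the standard basis of the Fock space. -/
def Ordered (l : List ℤ) : Prop := l.Pairwise (· < ·) ∧ ∀ k ∈ l, k ≤ 0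

/-- The degree of the monomial `φ_{k_1 - 1/2} ⋯ φ_{k_r - 1/2} |0⟩`: the number of odd `k_i` minus the
number of even `k_i`. -/
def deg (l : List ℤ) : ℤ :=
  (l.countP fun k => decide (Odd k) : ℤ) - (l.countP fun k => decide (Even k) : ℤ)

/-- The degree component `F_{(n)}` as a subspace: the span of the standard basis monomials of
degree `n`. -/
def homog (n : ℤ) : Submodule ℂ NeutralFock :=
  Submodule.span ℂ {v | ∃ l, Ordered l ∧ deg l = n ∧ v = word l}

theorem word_cons (k : ℤ) (l : List ℤ) : word (k :: l) = phi k (word l) := by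
  rw [word, word, List.map_cons, List.prod_cons, Module.End.mul_apply]

theorem deg_cons (k : ℤ) (l : List ℤ) : deg (k :: l) = (if Odd k then 1 else -1) + deg l := by
  unfold deg
  rw [List.countP_cons, List.countP_cons]
  by_cases hk : Odd k
  · have := Int.not_even_iff_odd.mpr hk
    simp [hk, this]
    omega
  · have := Int.not_odd_iff_even.mp hk
    simp [hk, this]
    omega

theorem phi_word (l : List ℤ) : ∀ y : ℤ, Ordered l → (∀ x ∈ l, y < x) → ∀ k, y < k →
    phi k (word l) ∈ Submodule.span ℂ
      {v | ∃ l', Ordered l' ∧ (∀ x ∈ l', y < x) ∧ deg l' = deg (k :: l) ∧ v = word l'} := by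
  induction l with
  | nil =>
    intro y _ _ k hk
    by_cases h : k ≤ 0
    · exact Submodule.subset_span
        ⟨[k], ⟨List.pairwise_singleton _ _, by simpa using h⟩, by simpa using hk, rfl,
          (word_cons k []).symm⟩
    · have : phi k (word []) = 0 := phi_vacuum (by omega)
      rw [this]
      exact Submodule.zero_mem _
  | cons x l ih =>
    intro y hl hy k hk
    obtain ⟨hp, hn⟩ := hl
    rw [List.pairwise_cons] at hp
    have hl' : Ordered l := ⟨hp.2, fun z hz => hn z (List.mem_cons_of_mem _ hz)⟩
    have hx0 : x ≤ 0 := hn x List.mem_cons_self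
    have hyx : y < x := hy x List.mem_cons_self
    have hc := LinearMap.congr_fun (phi_anticomm k x) (word l)
    rw [LinearMap.add_apply, Module.End.mul_apply, Module.End.mul_apply, LinearMap.smul_apply,
      Module.End.one_apply] at hc
    rcases lt_trichotomy k x with h | h | h
    · refine Submodule.subset_span ⟨k :: x :: l, ⟨?_, ?_⟩, ?_, rfl, (word_cons _ _).symm⟩
      · rw [List.pairwise_cons, List.pairwise_cons]
        refine ⟨?_, hp⟩
        intro z hz
        rcases List.mem_cons.mp hz with rfl | hz
        · exact h
        · exact h.trans (hp.1 z hz)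
      · intro z hz
        rcases List.mem_cons.mp hz with rfl | hz
        · omega
        · exact hn z hz
      · intro z hz
        rcases List.mem_cons.mp hz with rfl | hz
        · exact hk
        · exact hy z hz
    · subst h
      rw [neutralForm, if_neg (by omega), zero_smul, ← two_smul ℂ] at hc
      rw [word_cons, (smul_eq_zero.mp hc).resolve_left two_ne_zero]
      exact Submodule.zero_mem _
    · rw [word_cons, eq_sub_of_add_eq hc]
      refine Submodule.sub_mem _ ?_ ?_
      · unfold neutralForm
        split_ifs with hkx
        · rw [one_smul]
          refine Submodule.subset_span
            ⟨l, hl', fun z hz => hy z (List.mem_cons_of_mem _ hz), ?_, rfl⟩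
          rw [deg_cons, deg_cons]
          obtain rfl : k = 1 - x := by omega
          by_cases hx : Odd x
          · have : ¬ Odd (1 - x) := by
              rw [Int.not_odd_iff_even]
              exact odd_one.sub_odd hx
            simp [hx, this]
          · have : Odd (1 - x) := odd_one.sub_even (Int.not_odd_iff_even.mp hx)
            simp [hx, this]
        · rw [zero_smul]
          exact Submodule.zero_mem _
      · have hm := ih x hl' hp.1 k h
        generalize phi k (word l) = w at hm
        induction hm using Submodule.span_induction with
        | mem w hw =>
          obtain ⟨l', h1, h2, h3, rfl⟩ := hw
          refine Submodule.subset_span ⟨x :: l', ⟨?_, ?_⟩, ?_, ?_, (word_cons _ _).symm⟩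
          · exact List.pairwise_cons.mpr ⟨h2, h1.1⟩
          · intro z hz
            rcases List.mem_cons.mp hz with rfl | hz
            · exact hx0
            · exact h1.2 z hz
          · intro z hz
            rcases List.mem_cons.mp hz with rfl | hz
            · exact hyx
            · exact hyx.trans (h2 z hz)
          · rw [deg_cons, h3, deg_cons, deg_cons, deg_cons]
            ring
        | zero => rw [map_zero]; exact Submodule.zero_mem _
        | add v w _ _ hv hw => rw [map_add]; exact Submodule.add_mem _ hv hw
        | smul t v _ hv => rw [map_smul]; exact Submodule.smul_mem _ _ hv

theorem exists_lt (l : List ℤ) (k : ℤ) : ∃ y, y < k ∧ ∀ x ∈ l, y < x := by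
  induction l with
  | nil => exact ⟨k - 1, by omega, fun x hx => absurd hx List.not_mem_nil⟩
  | cons z l ih =>
    obtain ⟨y, h1, h2⟩ := ih
    refine ⟨min y (z - 1), lt_of_le_of_lt (min_le_left _ _) h1, fun x hx => ?_⟩
    rcases List.mem_cons.mp hx with rfl | hx
    · exact lt_of_le_of_lt (min_le_right _ _) (by omega)
    · exact lt_of_le_of_lt (min_le_left _ _) (h2 x hx)

theorem phi_mem {n : ℤ} {v : NeutralFock} (hv : v ∈ homog n) (k : ℤ) :
    phi k v ∈ homog (if Odd k then n + 1 else n - 1) := by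
  induction hv using Submodule.span_induction with
  | mem v h =>
    obtain ⟨l, hl, rfl, rfl⟩ := h
    obtain ⟨y, hk, hy⟩ := exists_lt l k
    refine Submodule.span_mono ?_ (phi_word l y hl hy k hk)
    rintro v ⟨l', h1, -, h3, rfl⟩
    refine ⟨l', h1, ?_, rfl⟩
    rw [h3, deg_cons]
    split_ifs <;> ring
  | zero => rw [map_zero]; exact Submodule.zero_mem _
  | add v w _ _ hv hw => rw [map_add]; exact Submodule.add_mem _ hv hw
  | smul t v _ hv => rw [map_smul]; exact Submodule.smul_mem _ _ hv

theorem nop_mem {n : ℤ} {v : NeutralFock} (hv : v ∈ homog n) (i j : ℤ) :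
    pair.nop i j v ∈ homog n := by
  have hi : Odd (-2 * i + 1) := ⟨-i, by ring⟩
  have hj : ¬ Odd (2 * j) := by
    rw [Int.not_odd_iff_even]
    exact ⟨j, by ring⟩
  unfold FermionPair.nop
  split_ifs
  · have h := phi_mem (phi_mem hv (-2 * i + 1)) (2 * j)
    rw [if_pos hi, if_neg hj, add_sub_cancel_right] at h
    exact Submodule.neg_mem _ h
  · have h := phi_mem (phi_mem hv (2 * j)) (-2 * i + 1)
    rw [if_pos hi, if_neg hj, sub_add_cancel] at h
    exact h

/-- The degree component `F_{(n)}` as a submodule for `r_1`. -/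
def component (n : ℤ) : LieSubmodule ℂ AInf NeutralFock where
  __ := homog n
  lie_mem := by
    intro x v hv
    obtain ⟨M, hM⟩ := (pair.act_eventually (AInf.mat x) v).exists
    rw [lie_eq, hM]
    exact Submodule.add_mem _ (Submodule.sum_mem _ fun i _ => Submodule.sum_mem _ fun j _ =>
      Submodule.smul_mem _ _ (nop_mem hv i j)) (Submodule.smul_mem _ _ hv)

end NeutralFock

/-! ### The Fock space of a pair of charged fermions -/

/-- `{ψ^+_m, ψ^-_n} = δ_{m + n, -1}`, `{ψ^±_m, ψ^±_n} = 0`; here `Sum.inl n` stands for `ψ^+_n` and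
`Sum.inr n` for `ψ^-_n`. -/
def chargedForm : ℤ ⊕ ℤ → ℤ ⊕ ℤ → ℂ
  | .inl m, .inr n => if m + n = -1 then 1 else 0
  | .inr m, .inl n => if m + n = -1 then 1 else 0
  | .inl _, .inl _ => 0
  | .inr _, .inr _ => 0

/-- The modes `ψ^±_n` with `n ≥ 0`, which annihilate the vacuum. -/
def chargedPos : Set (ℤ ⊕ ℤ) := {x | 0 ≤ Sum.elim id id x}

/-- The Fock space `F^{⊗ 1}` of a pair of charged free fermions. -/
def ChargedFock : Type := Fock chargedForm chargedPos

namespace ChargedFock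

instance : AddCommGroup ChargedFock := inferInstanceAs (AddCommGroup (Fock _ _))

instance : Module ℂ ChargedFock := inferInstanceAs (Module ℂ (Fock _ _))

/-- The operators `ψ^+_n`. -/
def psiPlus (n : ℤ) : Module.End ℂ ChargedFock := op chargedForm chargedPos (.inl n)

/-- The operators `ψ^-_n`. -/
def psiMinus (n : ℤ) : Module.End ℂ ChargedFock := op chargedForm chargedPos (.inr n)

/-- The operators `a_i = ψ^+_{-i}` and `b_j = ψ^-_{j - 1}`, the coefficients of `z^{i - 1}` in `ψ^+(z)`
and of `w^{-j}` in `ψ^-(w)`. -/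
def pair : FermionPair ChargedFock :=
  Fock.pair (β := chargedForm) (P := chargedPos)
    (fun x y => by
      rcases x with m | m <;> rcases y with n | n <;> simp [chargedForm, add_comm])
    (fun i => .inl (-i)) (fun j => .inr (j - 1))
    (fun i j => if_congr (by omega) rfl rfl)
    (fun i j => rfl) (fun i j => rfl)
    (fun i hi => by change 0 ≤ -i; omega)
    (fun j hj => by change 0 ≤ j - 1; omega)
    (fun x => by
      rcases x with m | m
      · exact Or.inl ⟨-m, by rw [neg_neg]⟩
      · exact Or.inr ⟨m + 1, by rw [add_sub_cancel_right]⟩)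

theorem pair_a (i : ℤ) : pair.a i = psiPlus (-i) := rfl

theorem pair_b (j : ℤ) : pair.b j = psiMinus (j - 1) := rfl

/-- The standard representation of `a_∞`, `∑ E_{ij} z^{i-1} w^{-j} ↦ :ψ^+(z) ψ^-(w):`, `c ↦ 1`. -/
instance : LieRingModule AInf ChargedFock := pair.lieRingModule

instance : LieModule ℂ AInf ChargedFock := pair.lieModule

theorem lie_eq (x : AInf) (v : ChargedFock) :
    ⁅x, v⁆ = pair.act (AInf.mat x) v + AInf.cen x • v := rfl

end ChargedFock

end

end FermionFock

namespace FermionFock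

open Filter Polynomial

noncomputable section

/-! ### Reduction to a line by polynomials in one operator -/

section NearLine

variable {A V : Type*} [Ring A] [Algebra ℂ A] [AddCommGroup V] [Module ℂ V] [Module A V]
  [IsScalarTower ℂ A V]

/-! In both Fock spaces the action of `a_∞` uses only operators `a_i`, `b_j` with `{a_i, b_j} =
δ_{ij}`. Think of the integers as levels, each filled (killed by `a_i`) or empty (killed by `b_i`).
The vacuum has exactly the levels `i ≤ 0` filled. The matrix unit `E_{ij}` moves a particle from
level `j` to level `i`, so it preserves the charge, and `E_{ji}` undoes the move.

Decomposition: the identity matrix acts on degree `n` by the scalar `n`, so the components are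
independent (`iSupIndep_homog`). They span because each mode shifts the degree by one
(`iSup_homog`).

Irreducibility: the idempotents `a_i b_i` and `b_i a_i` split a vector of a stable subspace into
vectors of that subspace in which every level is filled or empty (`mem_span_isPure`). Reversible
moves bring such a vector to one whose filled levels are exactly `i ≤ k` (`exists_isState_Iic`), and
the charge forces `k = n`. Vectors of this last kind form a line (`exists_highest`): for `n = 0` an
energy operator isolates the vacuum, and `a_{n+1}`, `b_{n+1}` carry the statement from each charge
to its neighbours. So every nonzero stable subspace of degree `n` contains the highest weight
vector, and that vector generates all of degree `n`. Linear independence of the monomials is never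
needed, only that the vacuum is nonzero (`vac_ne_zero`).

Identification with `L(Λ)`: the highest weight vector gives a surjection from the Verma module, and
its kernel must be the sum of the proper submodules. `diag(i)` separates the generator from
everything strictly below it, so a submodule not inside the kernel contains the generator
(`nonempty_equiv_irr`). The comparison with charged fermions is a relabelling of modes that respects
the relations and the vacuum conditions (`exists_fockEquiv`).

`nearLine` replaces projection to a weight space, both for the vacuum and for the Verma module. -/

theorem aeval_smul_eigen (h : A) {v : V} {μ : ℂ} (hv : h • v = μ • v) (p : ℂ[X]) :
    aeval h p • v = p.eval μ • v := by
  induction p using Polynomial.induction_on' with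
  | add p q hp hq => rw [map_add, add_smul, hp, hq, eval_add, add_smul]
  | monomial n t =>
    have hn : ∀ n : ℕ, h ^ n • v = μ ^ n • v := by
      intro n
      induction n with
      | zero => simp
      | succ n ih =>
        rw [pow_succ, mul_smul, hv, ← algebraMap_smul A μ v, ← mul_smul, ← Algebra.commutes,
          mul_smul, ih, algebraMap_smul, smul_smul, pow_succ']
    rw [aeval_monomial, mul_smul, hn, eval_monomial, algebraMap_smul, smul_smul]

/-- The vectors that some polynomial in `h`, not vanishing at the eigenvalue `μ` of `v`, maps to a
multiple of `v`. -/
def nearLine (h : A) (μ : ℂ) (v : V) (hv : h • v = μ • v) : Submodule ℂ V where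
  carrier := {x | ∃ p : ℂ[X], p.eval μ ≠ 0 ∧ ∃ t : ℂ, aeval h p • x = t • v}
  zero_mem' := ⟨1, by simp, 0, by simp⟩
  add_mem' := by
    rintro x y ⟨p, hp, s, hx⟩ ⟨q, hq, t, hy⟩
    -- Polynomials in `h` commute, so the product of the two witnesses serves both summands.
    refine ⟨p * q, by rw [eval_mul]; exact mul_ne_zero hp hq, q.eval μ * s + p.eval μ * t, ?_⟩
    have key : ∀ (p : ℂ[X]) (s : ℂ), aeval h p • s • v = (p.eval μ * s) • v := by
      intro p s
      rw [← algebraMap_smul A s v, ← mul_smul, ← Algebra.commutes, mul_smul,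
        aeval_smul_eigen h hv, algebraMap_smul, smul_smul, mul_comm]
    rw [smul_add, add_smul]
    congr 1
    · rw [mul_comm p q, map_mul, mul_smul, hx, key]
    · rw [map_mul, mul_smul, hy, key]
  smul_mem' := by
    rintro s x ⟨p, hp, t, hx⟩
    refine ⟨p, hp, s * t, ?_⟩
    rw [← algebraMap_smul A s x, ← mul_smul, ← Algebra.commutes, mul_smul, hx, algebraMap_smul,
      smul_smul]

theorem self_mem_nearLine (h : A) {μ : ℂ} {v : V} (hv : h • v = μ • v) :
    v ∈ nearLine h μ v hv :=
  ⟨1, by simp, 1, by simp⟩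

/-- The polynomial `X - ν` kills `x` and does not vanish at `μ`. Consequently `nearLine` is the
whole space as soon as `v` and eigenvectors with eigenvalues other than `μ` span. -/
theorem eigen_mem_nearLine (h : A) {μ ν : ℂ} {v x : V} (hv : h • v = μ • v)
    (hx : h • x = ν • x) (hν : ν ≠ μ) : x ∈ nearLine h μ v hv := by
  refine ⟨X - C ν, by simpa [sub_eq_zero] using hν.symm, 0, ?_⟩
  rw [aeval_smul_eigen h hx]
  simp

end NearLine

/-! ### Diagonal matrices -/

/-- The diagonal matrix `diag(d_i)`. -/
def diagBand (d : ℤ → ℂ) : Band :=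
  ⟨fun i j => if i = j then d i else 0, 0, fun i j h => if_neg fun hij => by simp [hij] at h⟩

theorem diagBand_apply_ne (d : ℤ → ℂ) (i j : ℤ) (h : i ≠ j) : (diagBand d).1 i j = 0 := if_neg h

theorem diagBand_apply_self (d : ℤ → ℂ) (i : ℤ) : (diagBand d).1 i i = d i := if_pos rfl

/-! ### Fermion pairs -/

namespace FermionPair

variable {F : Type} [AddCommGroup F] [Module ℂ F] (m : FermionPair F)

theorem a_b_apply (i j : ℤ) (v : F) :
    m.a i (m.b j v) = (if i = j then v else 0) - m.b j (m.a i v) := by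
  have h := LinearMap.congr_fun (m.ab i j) v
  rw [LinearMap.add_apply, Module.End.mul_apply, Module.End.mul_apply] at h
  rw [eq_sub_of_add_eq h]
  split_ifs <;> simp

theorem b_a_apply (i j : ℤ) (v : F) :
    m.b j (m.a i v) = (if i = j then v else 0) - m.a i (m.b j v) := by
  rw [a_b_apply, sub_sub_cancel]

theorem a_a_apply (i j : ℤ) (v : F) : m.a i (m.a j v) = -m.a j (m.a i v) :=
  LinearMap.congr_fun (m.a_comm i j) v

theorem b_b_apply (i j : ℤ) (v : F) : m.b i (m.b j v) = -m.b j (m.b i v) :=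
  LinearMap.congr_fun (m.b_comm i j) v

theorem a_sq_apply (i : ℤ) (v : F) : m.a i (m.a i v) = 0 := by
  have h := m.a_a_apply i i v
  rw [eq_neg_iff_add_eq_zero, ← two_smul ℂ] at h
  exact (smul_eq_zero.mp h).resolve_left two_ne_zero

theorem b_sq_apply (i : ℤ) (v : F) : m.b i (m.b i v) = 0 := by
  have h := m.b_b_apply i i v
  rw [eq_neg_iff_add_eq_zero, ← two_smul ℂ] at h
  exact (smul_eq_zero.mp h).resolve_left two_ne_zero

theorem nop_apply (i j : ℤ) (v : F) :
    m.nop i j v = m.a i (m.b j v) - (if i = j then ind i else 0) • v := by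
  rw [nop_eq]
  rfl

theorem nop_apply_of_ne {i j : ℤ} (h : i ≠ j) (v : F) : m.nop i j v = m.a i (m.b j v) := by
  rw [nop_apply, if_neg h, zero_smul, sub_zero]

/-- The subspace `N` is stable under all `:a_i b_j:`. -/
def Stable (N : Submodule ℂ F) : Prop := ∀ i j : ℤ, ∀ v ∈ N, m.nop i j v ∈ N

variable {m} in
theorem Stable.a_b_mem {N : Submodule ℂ F} (hN : m.Stable N) (i j : ℤ) {v : F} (hv : v ∈ N) :
    m.a i (m.b j v) ∈ N := by
  have h := N.add_mem (hN i j v hv) (N.smul_mem (if i = j then ind i else 0) hv)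
  rwa [nop_apply, sub_add_cancel] at h

/-- A vector on which, for every `i`, one of `a_i` and `b_i` vanishes. -/
def IsPure (v : F) : Prop := ∀ i, m.a i v = 0 ∨ m.b i v = 0

/-- A vector in which exactly the levels in `S` are occupied. -/
def IsState (S : Set ℤ) (v : F) : Prop := (∀ i ∈ S, m.a i v = 0) ∧ ∀ i, i ∉ S → m.b i v = 0

/-- The products `a_i b_i` and `b_i a_i` are complementary idempotents that preserve `N`. Only
finitely many levels of `v` are undecided, so finitely many splittings suffice. -/
theorem mem_span_isPure {N : Submodule ℂ F} (hN : m.Stable N) {v : F} (hv : v ∈ N) :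
    v ∈ Submodule.span ℂ {y | y ∈ N ∧ m.IsPure y} := by
  have key : ∀ s : Finset ℤ, ∀ v ∈ N, (∀ i, i ∉ s → m.a i v = 0 ∨ m.b i v = 0) →
      v ∈ Submodule.span ℂ {y | y ∈ N ∧ m.IsPure y} := by
    intro s
    induction s using Finset.induction_on with
    | empty => exact fun v hv h => Submodule.subset_span ⟨hv, fun i => h i (Finset.notMem_empty i)⟩
    | insert i s _ ih =>
      intro v hv h
      have h1 : m.a i (m.b i v) ∈ N := hN.a_b_mem i i hv
      -- In the first summand level `i` is filled, in the second it is empty; levels that were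
      -- already decided stay so.
      have h2 : v = m.a i (m.b i v) + m.b i (m.a i v) := by
        rw [a_b_apply, if_pos rfl, sub_add_cancel]
      have h3 : m.b i (m.a i v) ∈ N := by
        rw [b_a_apply, if_pos rfl]
        exact N.sub_mem hv h1
      rw [h2]
      refine Submodule.add_mem _ (ih _ h1 fun j hj => ?_) (ih _ h3 fun j hj => ?_)
      · by_cases hji : j = i
        · subst hji
          exact Or.inl (m.a_sq_apply _ _)
        · refine (h j (by simp [hji, hj])).imp (fun h => ?_) (fun h => ?_)
          · rw [a_a_apply, a_b_apply, h, if_neg hji]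
            simp
          · rw [b_a_apply, if_neg (Ne.symm hji), b_b_apply, h]
            simp
      · by_cases hji : j = i
        · subst hji
          exact Or.inr (m.b_sq_apply _ _)
        · refine (h j (by simp [hji, hj])).imp (fun h => ?_) (fun h => ?_)
          · rw [a_b_apply, if_neg hji, a_a_apply, h]
            simp
          · rw [b_b_apply, b_a_apply, if_neg (Ne.symm hji), h]
            simp
  -- Levels below the box are filled and levels above it are empty, so only the box needs splitting.
  obtain ⟨M, hb, ha⟩ := m.fin v
  refine key (box M) v hv fun i hi => ?_
  exact (not_mem_box hi).imp (ha i) (hb i)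

/-! ### Moving particles between levels -/

section Move

variable {m} {S : Set ℤ} {v : F}

theorem IsState.insert (hv : m.IsState S v) (i : ℤ) : m.IsState (insert i S) (m.a i v) := by
  refine ⟨fun k hk => ?_, fun k hk => ?_⟩
  · rcases Set.mem_insert_iff.mp hk with rfl | hk
    · exact m.a_sq_apply _ _
    · rw [a_a_apply, hv.1 k hk, map_zero, neg_zero]
  · rw [Set.mem_insert_iff, not_or] at hk
    rw [b_a_apply, if_neg (Ne.symm hk.1), hv.2 k hk.2, map_zero, sub_zero]

theorem IsState.erase (hv : m.IsState S v) (j : ℤ) : m.IsState (S \ {j}) (m.b j v) := by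
  refine ⟨fun k hk => ?_, fun k hk => ?_⟩
  · have hkj : k ≠ j := hk.2
    rw [a_b_apply, if_neg hkj, hv.1 k hk.1, map_zero, sub_zero]
  · by_cases hkj : k = j
    · subst hkj
      exact m.b_sq_apply _ _
    · rw [b_b_apply, hv.2 k fun h => hk ⟨h, hkj⟩, map_zero, neg_zero]

theorem IsState.a_b (hv : m.IsState S v) {j : ℤ} (hj : j ∈ S) : m.a j (m.b j v) = v := by
  rw [a_b_apply, hv.1 j hj, if_pos rfl, map_zero, sub_zero]

theorem IsState.b_a (hv : m.IsState S v) {j : ℤ} (hj : j ∉ S) : m.b j (m.a j v) = v := by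
  rw [b_a_apply, hv.2 j hj, if_pos rfl, map_zero, sub_zero]

/-- A move into an empty level is undone by the opposite move, so a stable subspace contains a state
exactly when it contains the moved one. -/
theorem IsState.move_back (hv : m.IsState S v) {i j : ℤ} (hi : i ∉ S) (hj : j ∈ S) :
    m.a j (m.b i (m.a i (m.b j v))) = v := by
  rw [(hv.erase j).b_a fun h => hi h.1, hv.a_b hj]

end Move

/-- As long as some empty level lies below a filled one, drop the particle into the hole. The total
height of the particles above `-M` is a natural number that decreases with every drop, so the
process ends with a down-closed set of filled levels. -/
theorem exists_isState_Iic_of_bounded (M : ℕ) : ∀ (e : ℕ) (T : Finset ℤ) (y : F), T ⊆ box M →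
    m.IsState {i | i < -(M : ℤ) ∨ i ∈ T} y → y ≠ 0 → ∑ i ∈ T, (i + M).toNat = e →
    ∃ (n : ℤ) (z : F), z ≠ 0 ∧ m.IsState (Set.Iic n) z ∧
      ∀ N : Submodule ℂ F, m.Stable N → (y ∈ N ↔ z ∈ N) := by
  intro e
  induction e using Nat.strong_induction_on with
  | _ e ih =>
  intro T y hT hy hy0 he
  set S : Set ℤ := {i | i < -(M : ℤ) ∨ i ∈ T} with hS
  have hTM : ∀ k ∈ T, -(M : ℤ) ≤ k ∧ k ≤ M := fun k hk => Finset.mem_Icc.mp (hT hk)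
  by_cases hd : ∀ i j : ℤ, i < j → j ∈ S → i ∈ S
  -- A down-closed set that is bounded above by `M` and contains `-M - 1` is some `Set.Iic n`.
  · obtain ⟨n, hn, hmax⟩ := Int.exists_greatest_of_bdd (P := fun i => i ∈ S)
      ⟨M, fun z hz => by
        rcases hz with hz | hz
        · omega
        · exact (hTM z hz).2⟩ ⟨-(M : ℤ) - 1, Or.inl (by omega)⟩
    have hSn : S = Set.Iic n := by
      ext i
      refine ⟨fun hi => hmax i hi, fun hi => ?_⟩
      rcases (Set.mem_Iic.mp hi).lt_or_eq with h | rfl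
      · exact hd i n h hn
      · exact hn
    exact ⟨n, y, hy0, hSn ▸ hy, fun N _ => Iff.rfl⟩
  · push Not at hd
    obtain ⟨i, j, hij, hj, hi⟩ := hd
    -- All levels below `-M` are filled, so the hole and the particle above it both lie in the box,
    -- where `toNat` truncates nothing.
    have hi' : -(M : ℤ) ≤ i ∧ i ∉ T := by
      simpa [hS] using hi
    have hj' : j ∈ T := hj.resolve_left (by omega)
    have hback := hy.move_back hi hj
    have hz0 : m.a i (m.b j y) ≠ 0 := fun h => hy0 (by rw [← hback, h, map_zero, map_zero])
    have hjM := hTM j hj'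
    have hiT : i ∉ T.erase j := fun h => hi'.2 (Finset.mem_of_mem_erase h)
    have hsum : ∑ k ∈ insert i (T.erase j), (k + M).toNat < e := by
      rw [Finset.sum_insert hiT]
      have := Finset.add_sum_erase T (fun k : ℤ => (k + M).toNat) hj'
      omega
    obtain ⟨n, z, hz, hzn, hN⟩ := ih _ hsum (insert i (T.erase j)) (m.a i (m.b j y))
      (fun k hk => by
        rcases Finset.mem_insert.mp hk with rfl | hk
        · exact Finset.mem_Icc.mpr (by omega)
        · exact hT (Finset.mem_of_mem_erase hk))
      (by
        have h := (hy.erase j).insert i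
        have hset : insert i (S \ {j}) = {k | k < -(M : ℤ) ∨ k ∈ insert i (T.erase j)} := by
          ext k
          simp only [hS, Set.mem_insert_iff, Set.mem_sdiff, Set.mem_ofPred_eq,
            Set.mem_singleton_iff, Finset.mem_insert, Finset.mem_erase]
          constructor
          · tauto
          · rintro (h | h | h)
            · exact Or.inr ⟨Or.inl h, by omega⟩
            · exact Or.inl h
            · exact Or.inr ⟨Or.inr h.2, h.1⟩
        rwa [hset] at h) hz0 rfl
    refine ⟨n, z, hz, hzn, fun N hNs => ?_⟩
    rw [← hN N hNs]
    exact ⟨fun h => hNs.a_b_mem i j h, fun h => hback ▸ hNs.a_b_mem j i h⟩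

/-- A nonzero pure vector can be moved, reversibly, to one whose occupied levels are `i ≤ n`. -/
theorem exists_isState_Iic {y : F} (hy : m.IsPure y) (hy0 : y ≠ 0) :
    ∃ (n : ℤ) (z : F), z ≠ 0 ∧ m.IsState (Set.Iic n) z ∧
      ∀ N : Submodule ℂ F, m.Stable N → (y ∈ N ↔ z ∈ N) := by
  classical
  obtain ⟨M, hb, ha⟩ := m.fin y
  refine m.exists_isState_Iic_of_bounded M _ ((box M).filter fun i => m.a i y = 0) y
    (Finset.filter_subset _ _) ?_ hy0 rfl
  refine ⟨fun i hi => ?_, fun i hi => ?_⟩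
  · rcases hi with hi | hi
    · exact ha i hi
    · exact (Finset.mem_filter.mp hi).2
  · by_cases h : i ∈ box M
    · exact (hy i).resolve_left fun h' => hi (Or.inr (Finset.mem_filter.mpr ⟨h, h'⟩))
    · rcases not_mem_box h with h | h
      · exact absurd (Or.inl h) hi
      · exact hb i h

/-! ### Diagonal matrices acting through fermion pairs -/

theorem act_diag_eventually {A : Band} (hA : ∀ i j, i ≠ j → A.1 i j = 0) (v : F) :
    ∀ᶠ M in atTop, m.act A v = ∑ i ∈ box M, A.1 i i • m.nop i i v := by
  filter_upwards [m.act_eventually A v] with M hM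
  rw [hM]
  refine Finset.sum_congr rfl fun i hi => ?_
  rw [Finset.sum_eq_single_of_mem i hi]
  intro j _ hj
  rw [hA i j hj.symm, zero_smul]

/-- The commutator of `:a_k b_k:` with `a_i` is `δ_{ki} a_i`; the normal ordering constant is a
scalar and drops out. -/
theorem act_diag_a {A : Band} (hA : ∀ i j, i ≠ j → A.1 i j = 0) (i : ℤ) (v : F) :
    m.act A (m.a i v) = m.a i (m.act A v) + A.1 i i • m.a i v := by
  obtain ⟨M, h1, h2, hM⟩ := ((m.act_diag_eventually hA v).and
    ((m.act_diag_eventually hA (m.a i v)).and (eventually_ge_atTop i.natAbs))).exists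
  have hi : i ∈ box M := Finset.mem_Icc.mpr (by omega)
  have h3 : ∀ k, m.nop k k (m.a i v) = m.a i (m.nop k k v) + if k = i then m.a i v else 0 := by
    intro k
    rw [nop_apply, nop_apply, b_a_apply, map_sub, map_sub, map_smul, m.a_a_apply k i]
    by_cases hk : k = i
    · subst hk
      simp
      abel
    · simp [hk, Ne.symm hk]
  rw [h1, h2]
  simp only [h3, smul_add, Finset.sum_add_distrib, map_sum, map_smul, smul_ite, smul_zero,
    Finset.sum_ite_eq', if_pos hi]

theorem act_diag_b {A : Band} (hA : ∀ i j, i ≠ j → A.1 i j = 0) (i : ℤ) (v : F) :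
    m.act A (m.b i v) = m.b i (m.act A v) - A.1 i i • m.b i v := by
  obtain ⟨M, h1, h2, hM⟩ := ((m.act_diag_eventually hA v).and
    ((m.act_diag_eventually hA (m.b i v)).and (eventually_ge_atTop i.natAbs))).exists
  have hi : i ∈ box M := Finset.mem_Icc.mpr (by omega)
  have h3 : ∀ k, m.nop k k (m.b i v) = m.b i (m.nop k k v) - if k = i then m.b i v else 0 := by
    intro k
    rw [nop_apply, nop_apply, map_sub, map_smul, b_a_apply, m.b_b_apply k i, map_neg]
    by_cases hk : k = i
    · subst hk
      simp
      abel
    · simp [hk]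
  rw [h1, h2]
  simp only [h3, smul_sub, Finset.sum_sub_distrib, map_sum, map_smul, smul_ite, smul_zero,
    Finset.sum_ite_eq', if_pos hi]

/-- On such a state `a_i b_i` is `1` for `i ≤ n` and `0` otherwise, and normal ordering subtracts
`1` for `i ≤ 0`. Only the levels between `0` and `n` survive, with the sign that defines the
fundamental weight. -/
theorem act_diag_isState {n : ℤ} {z : F} (hz : m.IsState (Set.Iic n) z) {A : Band}
    (hA : ∀ i j, i ≠ j → A.1 i j = 0) :
    m.act A z = (∑ i ∈ Finset.Ioc 0 n, A.1 i i - ∑ i ∈ Finset.Ioc n 0, A.1 i i) • z := by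
  obtain ⟨M, h1, hM⟩ := ((m.act_diag_eventually hA z).and (eventually_ge_atTop n.natAbs)).exists
  have h2 : ∀ i, m.nop i i z
      = ((if i ∈ Finset.Ioc 0 n then (1 : ℂ) else 0) - if i ∈ Finset.Ioc n 0 then 1 else 0) • z := by
    intro i
    rw [nop_apply, if_pos rfl, ind]
    by_cases hi : i ≤ n
    · rw [hz.a_b hi]
      by_cases h0 : i ≤ 0
      · simp [h0, hi, not_lt.mpr h0, not_lt.mpr hi]
      · simp [h0, hi, not_le.mp h0]
    · rw [hz.2 i hi]
      by_cases h0 : i ≤ 0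
      · simp [h0, not_lt.mpr h0, not_le.mp hi]
      · simp [h0, hi]
  rw [h1]
  simp only [h2, smul_smul, ← Finset.sum_smul, mul_sub, Finset.sum_sub_distrib, mul_ite, mul_one,
    mul_zero, Finset.sum_ite_mem]
  congr 3
  all_goals
    refine Finset.inter_eq_right.mpr fun i hi => ?_
    rw [Finset.mem_Ioc] at hi
    exact Finset.mem_Icc.mpr (by omega)

end FermionPair

/-! ### The universal property of Fock spaces -/

section FockMap

variable {X F : Type} {β : X → X → ℂ} {P : Set X} [AddCommGroup F] [Module ℂ F]

/-- A family of operators that satisfies the Clifford relations extends to the Clifford algebra. -/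
def cliffRep (T : X → Module.End ℂ F) (hT : ∀ x y, T x * T y + T y * T x = β x y • 1) :
    Cliff β →ₐ[ℂ] Module.End ℂ F :=
  CliffordAlgebra.lift (cliffForm β) ⟨Finsupp.linearCombination ℂ T, fun f => by
    set L := Finsupp.linearCombination ℂ T
    -- The polarized relation is bilinear and can be checked on the basis. On the diagonal it gives
    -- twice the square of `L f`, which the factor `1 / 2` in `cliffForm` absorbs.
    have key : (LinearMap.mul ℂ (Module.End ℂ F)).compl₁₂ L L
        + ((LinearMap.mul ℂ (Module.End ℂ F)).compl₁₂ L L).flip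
        = (Finsupp.linearCombination ℂ fun x => Finsupp.linearCombination ℂ (β x)).compr₂
          ((LinearMap.id : ℂ →ₗ[ℂ] ℂ).smulRight (1 : Module.End ℂ F)) := by
      ext x y : 4
      simpa [L] using hT x y
    have h := LinearMap.congr_fun₂ key f f
    simp only [LinearMap.add_apply, LinearMap.compl₁₂_apply, LinearMap.mul_apply',
      LinearMap.flip_apply, LinearMap.compr₂_apply, LinearMap.smulRight_apply,
      LinearMap.id_apply] at h
    rw [Algebra.algebraMap_eq_smul_one, cliffForm, smul_apply,
      LinearMap.BilinMap.toQuadraticMap_apply, smul_assoc, ← h, ← two_smul ℂ, smul_smul]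
    norm_num⟩

theorem cliffRep_gen (T : X → Module.End ℂ F) (hT : ∀ x y, T x * T y + T y * T x = β x y • 1)
    (x : X) : cliffRep T hT (gen β x) = T x := by
  simp [cliffRep, gen]

/-- The linear map from a Fock space determined by the image of the vacuum. -/
def fockMap (T : X → Module.End ℂ F) (hT : ∀ x y, T x * T y + T y * T x = β x y • 1)
    (v : F) (hv : ∀ x ∈ P, T x v = 0) : Fock β P →ₗ[ℂ] F :=
  ((vacIdeal β P).restrictScalars ℂ).liftQ
    ((LinearMap.applyₗ v).comp (cliffRep T hT).toLinearMap) (fun u hu => by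
      change cliffRep T hT u v = 0
      replace hu : u ∈ vacIdeal β P := hu
      induction hu using Submodule.span_induction with
      | mem u hu =>
        obtain ⟨x, hx, rfl⟩ := hu
        rw [cliffRep_gen, hv x hx]
      | zero => rw [map_zero, LinearMap.zero_apply]
      | add u w _ _ hu hw => rw [map_add, LinearMap.add_apply, hu, hw, add_zero]
      | smul a u _ hu =>
        rw [smul_eq_mul, map_mul, Module.End.mul_apply, hu, map_zero]) ∘ₗ
    (Submodule.Quotient.restrictScalarsEquiv ℂ (vacIdeal β P)).symm.toLinearMap

variable (T : X → Module.End ℂ F) (hT : ∀ x y, T x * T y + T y * T x = β x y • 1)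
  (v : F) (hv : ∀ x ∈ P, T x v = 0)

theorem fockMap_mk (u : Cliff β) :
    fockMap T hT v hv (Submodule.Quotient.mk (p := vacIdeal β P) u) = cliffRep T hT u v := rfl

theorem fockMap_vac : fockMap T hT v hv (vac β P) = v := by
  rw [vac, fockMap_mk, map_one, Module.End.one_apply]

theorem fockMap_op (x : X) (w : Fock β P) :
    fockMap T hT v hv (op β P x w) = T x (fockMap T hT v hv w) := by
  obtain ⟨u, rfl⟩ := Submodule.Quotient.mk_surjective (vacIdeal β P) w
  change fockMap T hT v hv (Submodule.Quotient.mk (p := vacIdeal β P) (gen β x * u)) = _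
  rw [fockMap_mk, fockMap_mk, map_mul, cliffRep_gen, Module.End.mul_apply]

/-- If `P` and its complement are isotropic, the vacuum is nonzero: creation operators act on the
exterior algebra by multiplication, annihilation operators by contraction. -/
theorem vac_ne_zero (hβ : ∀ x y, β x y = β y x) (h1 : ∀ x ∈ P, ∀ y ∈ P, β x y = 0)
    (h2 : ∀ x, x ∉ P → ∀ y, y ∉ P → β x y = 0) : vac β P ≠ 0 := by
  classical
  let Q : QuadraticForm ℂ (X →₀ ℂ) := 0
  let d : X → Module.Dual ℂ (X →₀ ℂ) := fun x => Finsupp.linearCombination ℂ (β x)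
  let T : X → Module.End ℂ (CliffordAlgebra Q) := fun x =>
    if x ∈ P then CliffordAlgebra.contractLeft (d x)
    else LinearMap.mulLeft ℂ (CliffordAlgebra.ι Q (Finsupp.single x 1))
  -- Contraction is an antiderivation, so its anticommutator with a multiplication is the scalar
  -- pairing.
  have mixed : ∀ x ∈ P, ∀ y, y ∉ P → T x * T y + T y * T x = β x y • 1 := by
    intro x hx y hy
    refine LinearMap.ext fun u => ?_
    simp only [T, if_pos hx, if_neg hy, LinearMap.add_apply, Module.End.mul_apply,
      LinearMap.mulLeft_apply, CliffordAlgebra.contractLeft_ι_mul, sub_add_cancel,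
      LinearMap.smul_apply, Module.End.one_apply]
    simp [d]
  have hT : ∀ x y, T x * T y + T y * T x = β x y • 1 := by
    intro x y
    by_cases hx : x ∈ P <;> by_cases hy : y ∈ P
    · rw [h1 x hx y hy, zero_smul]
      refine LinearMap.ext fun u => ?_
      simp only [T, if_pos hx, if_pos hy, LinearMap.add_apply, Module.End.mul_apply,
        LinearMap.zero_apply]
      rw [CliffordAlgebra.contractLeft_comm, neg_add_cancel]
    · exact mixed x hx y hy
    · rw [add_comm, hβ]
      exact mixed y hy x hx
    · rw [h2 x hx y hy, zero_smul]
      refine LinearMap.ext fun u => ?_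
      simp only [T, if_neg hx, if_neg hy, LinearMap.add_apply, Module.End.mul_apply,
        LinearMap.mulLeft_apply, LinearMap.zero_apply]
      rw [← mul_assoc, ← mul_assoc, ← add_mul, CliffordAlgebra.ι_mul_ι_add_swap]
      simp [Q, QuadraticMap.polar]
  intro h0
  have h := fockMap_vac (P := P) T hT 1 fun x hx => by
    simp only [T, if_pos hx]
    exact CliffordAlgebra.contractLeft_one _ _
  rw [h0, map_zero] at h
  exact zero_ne_one h

/-- Isomorphic data define isomorphic Fock spaces. -/
theorem exists_fockEquiv {Y : Type} {β' : Y → Y → ℂ} {P' : Set Y} (hβ : ∀ x y, β x y = β y x)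
    (hβ'_symm : ∀ x y, β' x y = β' y x) (e : X ≃ Y)
    (hform : ∀ x y, β' (e x) (e y) = β x y) (hP : ∀ x, e x ∈ P' ↔ x ∈ P) :
    ∃ f : Fock β P ≃ₗ[ℂ] Fock β' P', ∀ x w, f (op β P x w) = op β' P' (e x) (f w) := by
  let f : Fock β P →ₗ[ℂ] Fock β' P' := fockMap (fun x => op β' P' (e x))
    (fun x y => by rw [op_anticomm β' P' hβ'_symm, hform]) (vac β' P')
    (fun x hx => op_vac β' P' ((hP x).mpr hx))
  let g : Fock β' P' →ₗ[ℂ] Fock β P := fockMap (fun y => op β P (e.symm y))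
    (fun x y => by
      rw [op_anticomm β P hβ, ← hform, e.apply_symm_apply, e.apply_symm_apply]) (vac β P)
    (fun y hy => op_vac β P ((hP _).mp (by rwa [e.apply_symm_apply])))
  have hf : ∀ x w, f (op β P x w) = op β' P' (e x) (f w) := fun x w => fockMap_op _ _ _ _ x w
  have hg : ∀ y w, g (op β' P' y w) = op β P (e.symm y) (g w) := fun y w => fockMap_op _ _ _ _ y w
  have hfv : f (vac β P) = vac β' P' := fockMap_vac _ _ _ _
  have hgv : g (vac β' P') = vac β P := fockMap_vac _ _ _ _
  -- Both composites fix the vacuum and commute with the generators, and the vacuum generates.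
  refine ⟨LinearEquiv.ofLinearMap f g ?_ ?_, hf⟩
  · refine LinearMap.ext fun w => ?_
    induction w using fock_induction with
    | h0 => rw [map_zero, map_zero]
    | hv => rw [LinearMap.comp_apply, hgv, hfv, LinearMap.id_apply]
    | ha v w hv hw => rw [map_add, hv, hw, map_add]
    | hs t v hv => rw [map_smul, hv, map_smul]
    | ho x v hv =>
      rw [LinearMap.comp_apply, hg, hf, e.apply_symm_apply]
      exact congrArg _ hv
  · refine LinearMap.ext fun w => ?_
    induction w using fock_induction with
    | h0 => rw [map_zero, map_zero]
    | hv => rw [LinearMap.comp_apply, hfv, hgv, LinearMap.id_apply]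
    | ha v w hv hw => rw [map_add, hv, hw, map_add]
    | hs t v hv => rw [map_smul, hv, map_smul]
    | ho x v hv =>
      rw [LinearMap.comp_apply, hf, hg, e.symm_apply_apply]
      exact congrArg _ hv

end FockMap

/-! ### Comparison of the neutral and charged Fock spaces -/

/-- A linear map that intertwines two fermion pairs intertwines the actions of band matrices. -/
theorem FermionPair.map_act {F F' : Type} [AddCommGroup F] [Module ℂ F] [AddCommGroup F']
    [Module ℂ F'] (m : FermionPair F) (m' : FermionPair F') (f : F →ₗ[ℂ] F')
    (ha : ∀ i v, f (m.a i v) = m'.a i (f v)) (hb : ∀ i v, f (m.b i v) = m'.b i (f v))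
    (A : Band) (v : F) : f (m.act A v) = m'.act A (f v) := by
  obtain ⟨M, h1, h2⟩ := ((m.act_eventually A v).and (m'.act_eventually A (f v))).exists
  rw [h1, h2]
  simp only [map_sum, map_smul, FermionPair.nop_apply, map_sub, ha, hb]

/-- The bijection between the modes `ψ^±_n` of charged fermions and the modes `φ_{k - 1/2}` of a
neutral fermion, with `k = 2 n + 1` for `ψ^+_n` and `k = 2 n + 2` for `ψ^-_n`. -/
def chargedIndex : ℤ ⊕ ℤ ≃ ℤ :=
  Equiv.ofBijective (Sum.elim (fun n => 2 * n + 1) fun n => 2 * n + 2) <| by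
    constructor
    · rintro (m | m) (n | n) h <;> simp only [Sum.elim_inl, Sum.elim_inr] at h
      · exact congrArg _ (by omega)
      · omega
      · omega
      · exact congrArg _ (by omega)
    · intro k
      rcases Int.even_or_odd' k with ⟨j, hj | hj⟩
      · exact ⟨.inr (j - 1), by simp only [Sum.elim_inr]; omega⟩
      · exact ⟨.inl j, by simp only [Sum.elim_inl]; omega⟩

theorem chargedIndex_inl (n : ℤ) : chargedIndex (.inl n) = 2 * n + 1 := rfl

theorem chargedIndex_inr (n : ℤ) : chargedIndex (.inr n) = 2 * n + 2 := rfl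

/-- Under `chargedIndex` the modes `ψ^+_{-i}` and `ψ^-_{i-1}` become the modes with index `-2 i + 1`
and `2 i`, that is `a_i` and `b_i` of the neutral pair. Modes with `n ≥ 0` correspond to indices at
least `1`, so the two vacua match. -/
theorem nonempty_neutral_equiv_charged : Nonempty (NeutralFock ≃ₗ⁅ℂ, AInf⁆ ChargedFock) := by
  obtain ⟨f, hf⟩ := exists_fockEquiv (β := chargedForm) (P := chargedPos) (β' := neutralForm)
    (P' := {k : ℤ | 1 ≤ k})
    (fun x y => by rcases x with m | m <;> rcases y with n | n <;> simp [chargedForm, add_comm])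
    (fun k l => by simp only [neutralForm, add_comm]) chargedIndex
    (fun x y => by
      rcases x with m | m <;> rcases y with n | n <;>
        simp only [chargedForm, neutralForm, chargedIndex_inl, chargedIndex_inr]
      · exact if_neg (by omega)
      · exact if_congr (by omega) rfl rfl
      · exact if_congr (by omega) rfl rfl
      · exact if_neg (by omega))
    (fun x => by
      rcases x with m | m
      · change 1 ≤ 2 * m + 1 ↔ 0 ≤ m
        omega
      · change 1 ≤ 2 * m + 2 ↔ 0 ≤ m
        omega)
  let f' : ChargedFock ≃ₗ[ℂ] NeutralFock := f
  have ha : ∀ i v, f' (ChargedFock.pair.a i v) = NeutralFock.pair.a i (f' v) := by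
    intro i v
    refine (hf (.inl (-i)) v).trans ?_
    rw [chargedIndex_inl, NeutralFock.pair_a, mul_neg, ← neg_mul]
    rfl
  have hb : ∀ i v, f' (ChargedFock.pair.b i v) = NeutralFock.pair.b i (f' v) := by
    intro i v
    refine (hf (.inr (i - 1)) v).trans ?_
    rw [chargedIndex_inr, NeutralFock.pair_b, show 2 * (i - 1) + 2 = 2 * i by ring]
    rfl
  refine ⟨LieModuleEquiv.symm ⟨⟨f'.toLinearMap, fun {x v} => ?_⟩, f'.symm, f'.left_inv, f'.right_inv⟩⟩
  change f' ⁅x, v⁆ = ⁅x, f' v⁆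
  rw [ChargedFock.lie_eq, NeutralFock.lie_eq, map_add, map_smul]
  congr 1
  exact FermionPair.map_act _ _ f'.toLinearMap ha hb _ v

/-- The action of a band matrix as a linear map. -/
def FermionPair.actHom {F : Type} [AddCommGroup F] [Module ℂ F] (m : FermionPair F) (A : Band) :
    Module.End ℂ F where
  toFun := m.act A
  map_add' := m.act_add_right A
  map_smul' t v := m.act_smul_right t A v

/-! ### Grading, vacuum and highest weight vectors of the neutral Fock space -/

namespace NeutralFock

theorem phi_eq_pair_a {k : ℤ} (hk : Odd k) : phi k = pair.a ((1 - k) / 2) := by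
  rw [pair_a]
  obtain ⟨j, rfl⟩ := hk
  congr 1
  omega

theorem phi_eq_pair_b {k : ℤ} (hk : ¬ Odd k) : phi k = pair.b (k / 2) := by
  rw [pair_b]
  obtain ⟨j, rfl⟩ := Int.not_odd_iff_even.mp hk
  congr 1
  omega

theorem isState_vacuum : pair.IsState (Set.Iic 0) vacuum := by
  refine ⟨fun i hi => ?_, fun i hi => ?_⟩
  · rw [pair_a]
    have : i ≤ 0 := hi
    exact phi_vacuum (by omega)
  · rw [pair_b]
    have : ¬ i ≤ 0 := hi
    exact phi_vacuum (by omega)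

/-- The eigenvalue by which bracketing with `diag(d_i)` multiplies `φ_{k - 1/2}`. -/
def modeWeight (d : ℤ → ℂ) (k : ℤ) : ℂ := if Odd k then d ((1 - k) / 2) else -d (k / 2)

/-- Each mode is an eigenvector for the bracket with `diag(d_i)`, and the vacuum has weight zero, so
the weights of the modes add up. -/
theorem act_diag_word (d : ℤ → ℂ) (l : List ℤ) :
    pair.act (diagBand d) (word l) = (l.map (modeWeight d)).sum • word l := by
  have hd := diagBand_apply_ne d
  induction l with
  | nil =>
    have h := pair.act_diag_isState isState_vacuum hd
    rw [Finset.Ioc_self, Finset.sum_empty, sub_zero] at h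
    exact h
  | cons k l ih =>
    rw [word_cons, List.map_cons, List.sum_cons, add_smul, modeWeight]
    split_ifs with hk
    · rw [phi_eq_pair_a hk, pair.act_diag_a hd, ih, map_smul, diagBand_apply_self, add_comm]
    · rw [phi_eq_pair_b hk, pair.act_diag_b hd, ih, map_smul, diagBand_apply_self, neg_smul,
        sub_eq_neg_add]

theorem sum_modeWeight_one (l : List ℤ) : (l.map (modeWeight fun _ => 1)).sum = (deg l : ℂ) := by
  induction l with
  | nil => simp [deg]
  | cons k l ih =>
    rw [List.map_cons, List.sum_cons, ih, deg_cons, modeWeight]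
    split_ifs <;> simp

/-- The identity matrix acts on `F_{(n)}` by `n`. -/
theorem act_one_of_mem {n : ℤ} {v : NeutralFock} (hv : v ∈ homog n) :
    pair.act (diagBand fun _ => 1) v = (n : ℂ) • v := by
  have h : homog n ≤ (pair.actHom (diagBand fun _ => 1)).eigenspace (n : ℂ) := by
    refine Submodule.span_le.mpr ?_
    rintro _ ⟨l, -, rfl, rfl⟩
    refine Module.End.mem_eigenspace_iff.mpr ?_
    rw [← sum_modeWeight_one]
    exact act_diag_word _ l
  exact Module.End.mem_eigenspace_iff.mp (h hv)

/-- The components lie in eigenspaces of the identity matrix with distinct eigenvalues. -/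
theorem iSupIndep_homog : iSupIndep homog := by
  have h := (Module.End.eigenspaces_iSupIndep (pair.actHom (diagBand fun _ => 1))).comp
    (Int.cast_injective (α := ℂ))
  exact h.mono fun n v hv => Module.End.mem_eigenspace_iff.mpr (act_one_of_mem hv)

theorem vacuum_mem_homog : vacuum ∈ homog 0 :=
  Submodule.subset_span ⟨[], ⟨List.Pairwise.nil, fun _ h => absurd h List.not_mem_nil⟩, rfl, rfl⟩

/-- The sum of the components contains the vacuum and is stable under every mode. -/
theorem iSup_homog : ⨆ n, homog n = ⊤ := by
  refine eq_top_iff.mpr fun v _ => ?_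
  induction v using fock_induction with
  | h0 => exact Submodule.zero_mem _
  | hv => exact Submodule.mem_iSup_of_mem 0 vacuum_mem_homog
  | ha v w hv hw => exact Submodule.add_mem _ (hv trivial) (hw trivial)
  | hs t v hv => exact Submodule.smul_mem _ _ (hv trivial)
  | ho k v hv =>
    have h : (⨆ n, homog n) ≤ (⨆ n, homog n).comap (phi k) :=
      iSup_le fun n w hw => Submodule.mem_iSup_of_mem _ (phi_mem hw k)
    exact h (hv trivial)

theorem vacuum_ne_zero : vacuum ≠ 0 := by
  refine vac_ne_zero (fun k l => by simp only [neutralForm, add_comm]) (fun x hx y hy => ?_)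
    fun x hx y hy => ?_
  · simp only [Set.mem_ofPred_eq] at hx hy
    exact if_neg (by omega)
  · simp only [Set.mem_ofPred_eq] at hx hy
    exact if_neg (by omega)

/-- The diagonal `d_i = 2 i - 1`, for which all creation operators have positive weight. -/
def energy (i : ℤ) : ℂ := ((2 * i - 1 : ℤ) : ℂ)

theorem exists_sum_energy (l : List ℤ) (hl : ∀ k ∈ l, k ≤ 0) :
    ∃ e : ℕ, (l.map (modeWeight energy)).sum = e ∧ (l ≠ [] → e ≠ 0) := by
  induction l with
  | nil => exact ⟨0, by simp, fun h => absurd rfl h⟩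
  | cons k l ih =>
    obtain ⟨e, he, -⟩ := ih fun k hk => hl k (List.mem_cons_of_mem _ hk)
    have hk0 : k ≤ 0 := hl k List.mem_cons_self
    have hk : ∃ e : ℕ, modeWeight energy k = e ∧ e ≠ 0 := by
      rcases Int.even_or_odd' k with ⟨j, rfl | rfl⟩
      · refine ⟨(1 - 2 * j).toNat, ?_, by omega⟩
        rw [modeWeight, if_neg (by rw [Int.not_odd_iff_even]; exact even_two_mul j), energy,
          ← Int.cast_neg, ← Int.cast_natCast]
        exact congrArg _ (by omega)
      · refine ⟨(-(2 * j + 1)).toNat, ?_, by omega⟩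
        rw [modeWeight, if_pos ⟨j, rfl⟩, energy, ← Int.cast_natCast]
        exact congrArg _ (by omega)
    obtain ⟨e', he', h0⟩ := hk
    exact ⟨e' + e, by rw [List.map_cons, List.sum_cons, he, he', Nat.cast_add], fun _ => by omega⟩

/-- A vector annihilated by all annihilation operators is a multiple of the vacuum. -/
theorem exists_smul_vacuum {u : NeutralFock} (hu : pair.IsState (Set.Iic 0) u) :
    ∃ t : ℂ, u = t • vacuum := by
  -- The energy operator has eigenvalue `0` on every vector with the filling of the vacuum, and a
  -- nonzero eigenvalue on every nonempty ordered monomial.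
  set h := pair.actHom (diagBand energy)
  have h0 : ∀ u, pair.IsState (Set.Iic 0) u → h • u = (0 : ℂ) • u := by
    intro u hu
    have h := pair.act_diag_isState hu (diagBand_apply_ne energy)
    rw [Finset.Ioc_self, Finset.sum_empty, sub_zero] at h
    exact h
  have htop : ⨆ n, homog n ≤ nearLine h 0 vacuum (h0 _ isState_vacuum) := by
    refine iSup_le fun n => Submodule.span_le.mpr ?_
    rintro _ ⟨l, hl, -, rfl⟩
    by_cases hnil : l = []
    · subst hnil
      exact self_mem_nearLine h _
    · obtain ⟨e, he, he0⟩ := exists_sum_energy l hl.2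
      refine eigen_mem_nearLine h (ν := e) _ ?_ (by exact_mod_cast he0 hnil)
      rw [← he]
      exact act_diag_word energy l
  rw [iSup_homog] at htop
  obtain ⟨p, hp, t, ht⟩ := htop (Submodule.mem_top (x := u))
  -- Since `u` itself has energy `0`, the polynomial `p` acts on it by the nonzero scalar `p.eval
  -- 0`.
  rw [aeval_smul_eigen h (h0 u hu)] at ht
  refine ⟨(p.eval 0)⁻¹ * t, ?_⟩
  rw [mul_smul, ← ht, smul_smul, inv_mul_cancel₀ hp, one_smul]

/-- Filling level `n + 1` maps the states filled up to `n` bijectively to those filled up to `n +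
1`, with inverse `b_{n+1}`. Existence, nonvanishing and uniqueness thus spread from the vacuum in
both directions. -/
theorem exists_highest (n : ℤ) : ∃ v ∈ homog n, v ≠ 0 ∧ pair.IsState (Set.Iic n) v ∧
    ∀ u, pair.IsState (Set.Iic n) u → ∃ t : ℂ, u = t • v := by
  have hup : ∀ n : ℤ, insert (n + 1) (Set.Iic n) = Set.Iic (n + 1) := fun n => by
    ext k
    simp only [Set.mem_insert_iff, Set.mem_Iic]
    omega
  have hdown : ∀ n : ℤ, Set.Iic (n + 1) \ {n + 1} = Set.Iic n := fun n => by
    ext k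
    simp only [Set.mem_sdiff, Set.mem_Iic, Set.mem_singleton_iff]
    omega
  have hn1 : ∀ n : ℤ, n + 1 ∉ Set.Iic n := fun n => by simp
  have hn2 : ∀ n : ℤ, n + 1 ∈ Set.Iic (n + 1) := fun n => Set.mem_Iic.mpr le_rfl
  have ha : ∀ n i : ℤ, ∀ v ∈ homog n, pair.a i v ∈ homog (n + 1) := fun n i v hv => by
    have h := phi_mem hv (-2 * i + 1)
    rwa [if_pos ⟨-i, by ring⟩] at h
  have hb : ∀ n i : ℤ, ∀ v ∈ homog n, pair.b i v ∈ homog (n - 1) := fun n i v hv => by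
    have h := phi_mem hv (2 * i)
    rwa [if_neg (Int.not_odd_iff_even.mpr (even_two_mul i))] at h
  induction n using Int.induction_on with
  | zero =>
    exact ⟨vacuum, vacuum_mem_homog, vacuum_ne_zero, isState_vacuum, fun u hu =>
      exists_smul_vacuum hu⟩
  | succ n ih =>
    obtain ⟨v, hv, hv0, hs, huniq⟩ := ih
    refine ⟨pair.a (n + 1) v, ha _ _ _ hv, fun h => hv0 ?_, ?_, fun u hu => ?_⟩
    · rw [← hs.b_a (hn1 n), h, map_zero]
    · rw [← hup]
      exact hs.insert _
    · have h := hu.erase (n + 1)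
      rw [hdown] at h
      obtain ⟨t, ht⟩ := huniq _ h
      exact ⟨t, by rw [← map_smul, ← ht, hu.a_b (hn2 n)]⟩
  | pred n ih =>
    obtain ⟨k, hk⟩ : ∃ k : ℤ, k = -n - 1 := ⟨_, rfl⟩
    rw [← hk]
    have hk' : -(n : ℤ) = k + 1 := by omega
    rw [hk'] at ih
    obtain ⟨v, hv, hv0, hs, huniq⟩ := ih
    refine ⟨pair.b (k + 1) v, by simpa using hb _ (k + 1) _ hv, fun h => hv0 ?_, ?_, fun u hu => ?_⟩
    · rw [← hs.a_b (hn2 k), h, map_zero]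
    · rw [← hdown]
      exact hs.erase _
    · have h := hu.insert (k + 1)
      rw [hup] at h
      obtain ⟨t, ht⟩ := huniq _ h
      exact ⟨t, by rw [← map_smul, ← ht, hu.b_a (hn1 k)]⟩

/-! ### Irreducibility of the components -/

theorem stable_homog (n : ℤ) : pair.Stable (homog n) := fun i j _ hv => nop_mem hv i j

theorem stable_of_lieSubmodule (N : LieSubmodule ℂ AInf NeutralFock) :
    pair.Stable N.toSubmodule := by
  intro i j v hv
  have h := N.lie_mem (x := AInf.ofMat (E i j)) hv
  rw [lie_eq] at h
  change pair.act (E i j) v + (0 : ℂ) • v ∈ N at h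
  rwa [zero_smul, add_zero, pair.act_E] at h

/-- A nonzero pure vector of degree `n` generates the same stable subspaces as the highest weight
vector. -/
theorem pure_mem_iff {n : ℤ} {v y : NeutralFock}
    (huniq : ∀ u, pair.IsState (Set.Iic n) u → ∃ t : ℂ, u = t • v)
    (hy : pair.IsPure y) (hy0 : y ≠ 0) (hyn : y ∈ homog n) {N : Submodule ℂ NeutralFock}
    (hN : pair.Stable N) : y ∈ N ↔ v ∈ N := by
  obtain ⟨k, z, hz0, hz, hiff⟩ := pair.exists_isState_Iic hy hy0
  -- The component is itself a stable subspace, so `hiff` applies to it and the moves keep the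
  -- degree.
  have hzn : z ∈ homog n := (hiff _ (stable_homog n)).mp hyn
  have h1 := act_one_of_mem hzn
  rw [pair.act_diag_isState hz (diagBand_apply_ne _)] at h1
  have h2 := smul_left_injective ℂ hz0 h1
  simp only [diagBand_apply_self, Finset.sum_const, Int.card_Ioc, nsmul_eq_mul, mul_one] at h2
  -- The identity matrix acts on `z` by the degree `n` and, read off from the filling, by `k`.
  have h3 : k = n := by
    have h4 : (((k - 0).toNat : ℤ) - ((0 - k).toNat : ℤ) : ℤ) = n := by exact_mod_cast h2
    omega
  subst h3
  obtain ⟨t, rfl⟩ := huniq z hz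
  have ht : t ≠ 0 := fun h => hz0 (by rw [h, zero_smul])
  rw [hiff N hN, N.smul_mem_iff ht]

/-- A nonzero vector of degree `n` in `N` has a nonzero pure part in `N`, which is as good as the
highest weight vector. That vector then yields all pure vectors of degree `n`, and these span. -/
theorem homog_le_of_stable {n : ℤ} {N : Submodule ℂ NeutralFock} (hN : pair.Stable N)
    {x : NeutralFock} (hx : x ∈ N) (hxn : x ∈ homog n) (hx0 : x ≠ 0) : homog n ≤ N := by
  obtain ⟨v, hv, -, -, huniq⟩ := exists_highest n
  have hst : pair.Stable (N ⊓ homog n) :=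
    fun i j v hv => ⟨hN i j v hv.1, stable_homog n i j v hv.2⟩
  have hvN : v ∈ N := by
    by_contra hvN
    have h := pair.mem_span_isPure hst (v := x) ⟨hx, hxn⟩
    have h' : Submodule.span ℂ {y | y ∈ N ⊓ homog n ∧ pair.IsPure y} ≤ ⊥ := by
      refine Submodule.span_le.mpr ?_
      rintro y ⟨⟨hyN, hyn⟩, hy⟩
      by_contra hy0
      exact hvN ((pure_mem_iff huniq hy hy0 hyn hN).mp hyN)
    exact hx0 (h' h)
  intro w hw
  refine Submodule.span_le.mpr ?_ (pair.mem_span_isPure (stable_homog n) hw)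
  rintro y ⟨hyn, hy⟩
  by_cases hy0 : y = 0
  · rw [hy0]
    exact N.zero_mem
  · exact (pure_mem_iff huniq hy hy0 hyn hN).mpr hvN

theorem isIrreducible_component (n : ℤ) : LieModule.IsIrreducible ℂ AInf (component n) := by
  obtain ⟨v, hv, hv0, -, -⟩ := exists_highest n
  have : Nontrivial (component n) := ⟨⟨v, hv⟩, 0, fun h => hv0 (congrArg Subtype.val h)⟩
  refine LieModule.IsIrreducible.mk fun N hN => ?_
  obtain ⟨x, hx, hx0⟩ : ∃ x ∈ N, x ≠ 0 := by
    by_contra! h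
    exact hN ((LieSubmodule.eq_bot_iff N).mpr h)
  have hle := homog_le_of_stable (stable_of_lieSubmodule (N.map (component n).incl))
    (x := x.1) ⟨x, hx, rfl⟩ x.2 fun h => hx0 (Subtype.ext h)
  refine eq_top_iff.mpr fun w _ => ?_
  obtain ⟨w', hw', h⟩ := hle w.2
  exact (Subtype.ext h : w' = w) ▸ hw'

end NeutralFock

/-! ### Verma modules -/

local notation "ι" => UniversalEnvelopingAlgebra.ι ℂ

/-- The element `diag(i)`, which defines the principal gradation. -/
def principal : AInf := AInf.ofMat (diagBand fun i => (i : ℂ))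

theorem principal_mem_cartan : principal ∈ cartan := fun i j h => diagBand_apply_ne _ i j h

/-- Each `E_{ij}` has weight `i - j`, so a whole diagonal is homogeneous even with infinitely many
nonzero entries. The cocycle vanishes because `J` commutes with diagonal matrices. -/
theorem lie_principal {A : Band} {d : ℤ} (hA : ∀ i j, i - j ≠ d → A.1 i j = 0) :
    ⁅principal, AInf.ofMat A⁆ = (d : ℂ) • AInf.ofMat A := by
  set D := diagBand fun i => (i : ℂ)
  refine AInf.ext' (Band.ext' fun i j => ?_) ?_
  · change (D * A).1 i j - (A * D).1 i j = (d : ℂ) * A.1 i j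
    rw [Band.mul_apply_eq D A i j {i} fun k hk => by
        rw [diagBand_apply_ne _ i k (Ne.symm (by simpa using hk)), zero_mul],
      Band.mul_apply_eq A D i j {j} fun k hk => by
        rw [diagBand_apply_ne _ k j (by simpa using hk), mul_zero],
      Finset.sum_singleton, Finset.sum_singleton, diagBand_apply_self, diagBand_apply_self]
    by_cases h : i - j = d
    · rw [← h]
      push_cast
      ring
    · rw [hA i j h]
      ring
  · change cocycle D A = (d : ℂ) * 0
    obtain ⟨M, hM⟩ := (cocycle_eventually D).exists
    rw [hM, mul_zero]
    refine Finset.sum_eq_zero fun i _ => Finset.sum_eq_zero fun j _ => ?_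
    by_cases h : i = j
    · rw [h, sub_self, zero_mul, zero_mul]
    · rw [diagBand_apply_ne _ i j h, mul_zero, zero_mul]

/-- The part of a band matrix supported on the positions `(i, j)` with `s (i - j)`. -/
def bandPart (s : ℤ → Prop) (A : Band) : Band := by
  classical
  exact ⟨fun i j => if s (i - j) then A.1 i j else 0, by
    obtain ⟨N, hN⟩ := A.2
    refine ⟨N, fun i j h => ?_⟩
    change (if s (i - j) then A.1 i j else 0) = 0
    rw [hN i j h, ite_self]⟩

theorem bandPart_apply_of_pos {s : ℤ → Prop} (A : Band) {i j : ℤ} (h : s (i - j)) :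
    (bandPart s A).1 i j = A.1 i j := if_pos h

theorem bandPart_apply_of_neg {s : ℤ → Prop} (A : Band) {i j : ℤ} (h : ¬ s (i - j)) :
    (bandPart s A).1 i j = 0 := if_neg h

/-- Triangular decomposition, with the lower triangular part split into diagonals. -/
theorem exists_triangular (x : AInf) : ∃ u ∈ upper, ∃ h ∈ cartan, ∃ (N : ℕ) (y : ℕ → AInf),
    (∀ d, ⁅principal, y d⁆ = ((d + 1 : ℕ) : ℂ) • y d) ∧ x = u + h + ∑ d ∈ Finset.range N, y d := by
  obtain ⟨N, hN⟩ := (AInf.mat x).width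
  set A := AInf.mat x with hA
  set u := AInf.ofMat (bandPart (· < 0) A)
  set y : ℕ → AInf := fun d => AInf.ofMat (bandPart (· = ((d + 1 : ℕ) : ℤ)) A)
  -- The Cartan part is defined as the remainder and so absorbs the central component. Bounded width
  -- leaves finitely many lower diagonals; index `d` stands for the diagonal `i - j = d + 1`, so
  -- every weight is positive.
  refine ⟨u, ⟨rfl, fun i j hij => bandPart_apply_of_neg (s := (· < 0)) A (by omega)⟩,
    x - u - ∑ d ∈ Finset.range N, y d, ?_, N, y, fun d => ?_, by abel⟩
  · intro i j hij
    let entry : AInf →ₗ[ℂ] ℂ :=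
      { toFun := fun x => (AInf.mat x).1 i j, map_add' := fun _ _ => rfl, map_smul' := fun _ _ => rfl }
    change entry (x - u - ∑ d ∈ Finset.range N, y d) = 0
    rw [map_sub, map_sub, map_sum]
    change A.1 i j - (bandPart (· < 0) A).1 i j
      - ∑ d ∈ Finset.range N, (bandPart (· = ((d + 1 : ℕ) : ℤ)) A).1 i j = 0
    rcases lt_or_gt_of_ne hij with h | h
    · rw [bandPart_apply_of_pos (s := (· < 0)) A (by omega), Finset.sum_eq_zero, sub_self, sub_zero]
      intro d _
      refine bandPart_apply_of_neg A fun hc => ?_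
      omega
    · rw [bandPart_apply_of_neg (s := (· < 0)) A (by omega), sub_zero]
      by_cases hw : (N : ℤ) < |i - j|
      · rw [hN i j hw, Finset.sum_eq_zero, sub_self]
        intro d hd
        refine bandPart_apply_of_neg A fun hc => ?_
        rw [Finset.mem_range] at hd
        rw [abs_of_pos (by omega)] at hw
        omega
      · rw [abs_of_pos (by omega)] at hw
        rw [Finset.sum_eq_single_of_mem (i - j - 1).toNat (Finset.mem_range.mpr (by omega)),
          bandPart_apply_of_pos A, sub_self]
        · omega
        · intro d _ hd
          refine bandPart_apply_of_neg A fun hc => ?_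
          omega
  · have h := lie_principal (A := bandPart (· = ((d + 1 : ℕ) : ℤ)) A) (d := ((d + 1 : ℕ) : ℤ))
      fun i j hij => bandPart_apply_of_neg A hij
    rwa [Int.cast_natCast] at h

theorem uea_mul_swap (x y : AInf) : ι x * ι y = ι ⁅x, y⁆ + ι y * ι x := by
  let _ : LieRing UAInf := LieRing.ofAssociativeRing
  rw [LieHom.map_lie, LieRing.of_associative_ring_bracket, sub_add_cancel]

/-- The elements satisfying `p` form a subalgebra through which `ι` factors; by the universal
property the lift followed by the inclusion is the identity. -/
theorem uea_induction {p : UAInf → Prop} (hs : ∀ t : ℂ, p (algebraMap ℂ UAInf t))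
    (hι : ∀ x, p (ι x)) (hadd : ∀ a b, p a → p b → p (a + b)) (hmul : ∀ a b, p a → p b → p (a * b))
    (u : UAInf) : p u := by
  let S : Subalgebra ℂ UAInf :=
    { carrier := {u | p u}
      mul_mem' := fun {a b} => hmul a b
      add_mem' := fun {a b} => hadd a b
      algebraMap_mem' := hs }
  let _ : LieRing UAInf := LieRing.ofAssociativeRing
  let _ : LieRing S := LieRing.ofAssociativeRing
  let _ : LieAlgebra ℂ S := LieAlgebra.ofAssociativeAlgebra
  let f : AInf →ₗ⁅ℂ⁆ S :=
    { toFun := fun x => ⟨ι x, hι x⟩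
      map_add' := fun x y => Subtype.ext (map_add _ x y)
      map_smul' := fun t x => Subtype.ext (map_smul _ t x)
      map_lie' := fun {x y} => Subtype.ext (by
        change ι ⁅x, y⁆ = ι x * ι y - ι y * ι x
        rw [uea_mul_swap, add_sub_cancel_right]) }
  have h : S.val.comp (UniversalEnvelopingAlgebra.lift ℂ f) = AlgHom.id ℂ UAInf := by
    refine UniversalEnvelopingAlgebra.hom_ext ℂ (LieHom.ext fun x => ?_)
    change ((UniversalEnvelopingAlgebra.lift ℂ f (ι x) : S) : UAInf) = ι x
    rw [UniversalEnvelopingAlgebra.lift_ι_apply]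
    rfl
  have h2 := DFunLike.congr_fun h u
  change ((UniversalEnvelopingAlgebra.lift ℂ f u : S) : UAInf) = u at h2
  rw [← h2]
  exact (UniversalEnvelopingAlgebra.lift ℂ f u).2

/-! ### Vectors below a highest weight vector -/

section LowerWord

variable {V : Type*} [AddCommGroup V] [Module ℂ V] [Module UAInf V]

/-- The vectors obtained from `v` by successively applying homogeneous strictly lower triangular
elements of total degree `e`. -/
inductive LowerWord (v : V) : ℕ → V → Prop
  | nil : LowerWord v 0 v
  | cons (y : AInf) (d e : ℕ) (w : V) (hy : ⁅principal, y⁆ = ((d + 1 : ℕ) : ℂ) • y)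
      (hw : LowerWord v e w) : LowerWord v (e + (d + 1)) (ι y • w)

variable [IsScalarTower ℂ UAInf V]

theorem uea_smul_comm (u : UAInf) (t : ℂ) (w : V) : u • t • w = t • u • w := by
  rw [← algebraMap_smul UAInf t w, ← mul_smul, ← Algebra.commutes, mul_smul, algebraMap_smul]

theorem LowerWord.eigen {v w : V} {e : ℕ} (hw : LowerWord v e w) {μ : ℂ}
    (hv : ι principal • v = μ • v) : ι principal • w = (μ + e) • w := by
  induction hw with
  | nil => rw [hv, Nat.cast_zero, add_zero]
  | cons y d e w hy _ ih =>
    rw [← mul_smul, uea_mul_swap, hy, add_smul, mul_smul, ih, map_smul, smul_assoc, uea_smul_comm,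
      ← add_smul]
    congr 1
    push_cast
    ring

/-- This is the part of the Poincaré–Birkhoff–Witt theorem that is needed: no ordering of the
factors and no linear independence, only that lower triangular words span. -/
theorem span_lowerWord {v : V} (Λ : Module.Dual ℂ cartan) (hup : ∀ x ∈ upper, ι x • v = 0)
    (hc : ∀ h : cartan, ι h.1 • v = Λ h • v) (u : UAInf) :
    u • v ∈ Submodule.span ℂ {w | ∃ e, LowerWord v e w} := by
  set W := Submodule.span ℂ {w | ∃ e, LowerWord v e w}
  have hlow : ∀ (y : AInf) (d : ℕ), ⁅principal, y⁆ = ((d + 1 : ℕ) : ℂ) • y →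
      ∀ w ∈ W, ι y • w ∈ W := by
    intro y d hy w hw
    induction hw using Submodule.span_induction with
    | mem w hw =>
      obtain ⟨e, hw⟩ := hw
      exact Submodule.subset_span ⟨_, LowerWord.cons y d e w hy hw⟩
    | zero => rw [smul_zero]; exact W.zero_mem
    | add a b _ _ ha hb => rw [smul_add]; exact W.add_mem ha hb
    | smul t a _ ha => rw [uea_smul_comm]; exact W.smul_mem _ ha
  have hv : v ∈ W := Submodule.subset_span ⟨0, LowerWord.nil⟩
  have hword : ∀ e w, LowerWord v e w → ∀ x : AInf, ι x • w ∈ W := by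
    intro e w hw
    induction hw with
    | nil =>
      intro x
      obtain ⟨a, ha, h, hh, N, y, hy, rfl⟩ := exists_triangular x
      rw [map_add, map_add, map_sum, add_smul, add_smul, Finset.sum_smul, hup a ha, zero_add]
      refine W.add_mem ?_ (W.sum_mem fun d _ => hlow _ d (hy d) v hv)
      rw [hc ⟨h, hh⟩]
      exact W.smul_mem _ hv
    | cons y d e w hy _ ih =>
      intro x
      -- Commuting `x` past `y` leaves `⁅x, y⁆` and `x` acting on the shorter word. The induction
      -- hypothesis covers both since it holds for all elements of the Lie algebra.
      rw [← mul_smul, uea_mul_swap, add_smul, mul_smul]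
      exact W.add_mem (ih _) (hlow y d hy _ (ih x))
  have hstab : ∀ w ∈ W, u • w ∈ W := by
    induction u using uea_induction with
    | hs t => intro w hw; rw [algebraMap_smul]; exact W.smul_mem _ hw
    | hι x =>
      intro w hw
      induction hw using Submodule.span_induction with
      | mem w hw =>
        obtain ⟨e, hw⟩ := hw
        exact hword e w hw x
      | zero => rw [smul_zero]; exact W.zero_mem
      | add a b _ _ ha hb => rw [smul_add]; exact W.add_mem ha hb
      | smul t a _ ha => rw [uea_smul_comm]; exact W.smul_mem _ ha
    | hadd a b ha hb => intro w hw; rw [add_smul]; exact W.add_mem (ha w hw) (hb w hw)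
    | hmul a b ha hb => intro w hw; rw [mul_smul]; exact ha _ (hb w hw)
  exact hstab v hv

/-- A nonempty lower word has its `principal` eigenvalue raised by a positive integer, hence
different from that of `v`. -/
theorem mem_nearLine_of_highest {v : V} (Λ : Module.Dual ℂ cartan)
    (hup : ∀ x ∈ upper, ι x • v = 0) (hc : ∀ h : cartan, ι h.1 • v = Λ h • v) (u : UAInf) :
    u • v ∈ nearLine (ι principal) (Λ ⟨principal, principal_mem_cartan⟩) v
      (hc ⟨principal, principal_mem_cartan⟩) := by
  refine Submodule.span_le.mpr ?_ (span_lowerWord Λ hup hc u)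
  rintro w ⟨e, hw⟩
  cases hw with
  | nil => exact self_mem_nearLine _ _
  | cons y d e w hy hw =>
    refine eigen_mem_nearLine _ _ ((LowerWord.cons y d e w hy hw).eigen
      (hc ⟨principal, principal_mem_cartan⟩)) ?_
    intro h
    rw [add_eq_left] at h
    exact absurd h (Nat.cast_ne_zero.mpr (by omega))

end LowerWord

/-! ### Recognition of the irreducible highest weight module -/

/-- An irreducible module with a highest weight vector is the irreducible quotient of the Verma
module. -/
theorem nonempty_equiv_irr {M : Type} [AddCommGroup M] [Module ℂ M] [LieRingModule AInf M]
    [LieModule ℂ AInf M] (hM : LieModule.IsIrreducible ℂ AInf M) (Λ : Module.Dual ℂ cartan)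
    {v : M} (hv0 : v ≠ 0) (hup : ∀ x ∈ upper, ⁅x, v⁆ = 0) (hc : ∀ h : cartan, ⁅h.1, v⁆ = Λ h • v) :
    Nonempty (M ≃ₗ⁅ℂ, AInf⁆ Irr Λ) := by
  let ρ : UAInf →ₐ[ℂ] Module.End ℂ M := UniversalEnvelopingAlgebra.lift ℂ (LieModule.toEnd ℂ AInf M)
  let _ : Module UAInf M := Module.compHom M ρ.toRingHom
  have hρ : ∀ (x : AInf) (w : M), ι x • w = ⁅x, w⁆ := fun x w => by
    change ρ (ι x) w = _
    simp only [ρ]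
    rw [UniversalEnvelopingAlgebra.lift_ι_apply]
    rfl
  have hsc : ∀ (t : ℂ) (w : M), algebraMap ℂ UAInf t • w = t • w := fun t w => by
    change ρ (algebraMap ℂ UAInf t) w = _
    rw [AlgHom.commutes]
    rfl
  have : IsScalarTower ℂ UAInf M := ⟨fun t u w => by
    rw [Algebra.smul_def, mul_smul, hsc]⟩
  have hsub : ∀ N : Submodule UAInf M, N ≠ ⊥ → N = ⊤ := by
    intro N hN
    let N' : LieSubmodule ℂ AInf M :=
      { N.restrictScalars ℂ with
        lie_mem := fun {x w} hw => by
          rw [← hρ]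
          exact N.smul_mem _ hw }
    have h := hM.eq_bot_or_eq_top N'
    rcases h with h | h
    · refine absurd (eq_bot_iff.mpr fun w hw => ?_) hN
      have : w ∈ N' := hw
      rw [h] at this
      exact this
    · refine eq_top_iff.mpr fun w _ => ?_
      have : w ∈ N' := by
        rw [h]
        trivial
      exact this
  have hker : vermaIdeal Λ ≤ LinearMap.ker (LinearMap.toSpanSingleton UAInf M v) := by
    refine Submodule.span_le.mpr ?_
    rintro u (⟨x, hx, rfl⟩ | ⟨h, rfl⟩)
    · change ι x • v = 0
      rw [hρ, hup x hx]
    · change (ι h.1 - algebraMap ℂ UAInf (Λ h)) • v = 0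
      rw [sub_smul, hρ, hsc, hc, sub_self]
  let q : Verma Λ →ₗ[UAInf] M := (vermaIdeal Λ).liftQ (LinearMap.toSpanSingleton UAInf M v) hker
  let v' : Verma Λ := Submodule.Quotient.mk 1
  have hgen : ∀ u : UAInf, (Submodule.Quotient.mk u : Verma Λ) = u • v' := fun u => by
    rw [← Submodule.Quotient.mk_smul, smul_eq_mul, mul_one]
  have hqv : q v' = v := one_smul UAInf v
  have hup' : ∀ x ∈ upper, ι x • v' = 0 := fun x hx => by
    rw [← hgen, Submodule.Quotient.mk_eq_zero]
    exact Submodule.subset_span (Or.inl ⟨x, hx, rfl⟩)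
  have hc' : ∀ h : cartan, ι h.1 • v' = Λ h • v' := fun h => by
    rw [← algebraMap_smul UAInf (Λ h) v', ← sub_eq_zero, ← sub_smul, ← hgen,
      Submodule.Quotient.mk_eq_zero]
    exact Submodule.subset_span (Or.inr ⟨h, rfl⟩)
  have hq : Function.Surjective q := by
    refine LinearMap.range_eq_top.mp (hsub _ fun h => hv0 ?_)
    have : v ∈ LinearMap.range q := ⟨v', hqv⟩
    rwa [h] at this
  -- The kernel is proper because `v` is nonzero. Conversely, a submodule outside the kernel maps
  -- onto the irreducible `M`, and turns out to contain the generator.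
  have hsup : sSup {N : Submodule UAInf (Verma Λ) | N ≠ ⊤} = LinearMap.ker q := by
    refine le_antisymm (sSup_le fun N hN => ?_) (le_sSup fun h => hv0 ?_)
    · by_contra hle
      have hmap : N.map q = ⊤ := hsub _ fun h => hle (LinearMap.le_ker_iff_map.mpr h)
      obtain ⟨x, hx, hxv⟩ : v ∈ N.map q := by
        rw [hmap]
        trivial
      obtain ⟨u, rfl⟩ := Submodule.Quotient.mk_surjective _ x
      rw [hgen] at hx hxv
      -- A preimage of `v` in `N` is pushed by `p` to `t • v'`. Applying `q` compares `t • v` with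
      -- the nonzero multiple `p(μ) • v`, where `μ` is the `principal` eigenvalue of `v`, so `t`
      -- cannot vanish.
      obtain ⟨p, hp, t, ht⟩ := mem_nearLine_of_highest Λ hup' hc' u
      have ht0 : t ≠ 0 := by
        rintro rfl
        have h := congrArg q ht
        rw [map_smul, hxv, zero_smul, map_zero,
          aeval_smul_eigen (μ := Λ ⟨principal, principal_mem_cartan⟩) _
            ((hρ _ _).trans (hc ⟨principal, principal_mem_cartan⟩))] at h
        exact (smul_eq_zero.mp h).elim hp hv0
      have hv'N : v' ∈ N := by
        have h := N.smul_mem (aeval (ι principal) p) hx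
        rw [ht, ← algebraMap_smul UAInf t v'] at h
        have h' := N.smul_mem (algebraMap ℂ UAInf t⁻¹) h
        rwa [← mul_smul, ← map_mul, inv_mul_cancel₀ ht0, map_one, one_smul] at h'
      refine hN (eq_top_iff.mpr fun x _ => ?_)
      obtain ⟨u, rfl⟩ := Submodule.Quotient.mk_surjective _ x
      rw [hgen]
      exact N.smul_mem _ hv'N
    · rw [← hqv]
      exact LinearMap.mem_ker.mp (h ▸ Submodule.mem_top)
  let f : Irr Λ ≃ₗ[UAInf] M :=
    (Submodule.quotEquivOfEq _ _ hsup).trans (q.quotKerEquivOfSurjective hq)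
  refine ⟨LieModuleEquiv.symm ⟨⟨⟨⟨f, map_add f⟩, fun t w => ?_⟩, fun {x w} => ?_⟩, f.symm,
    f.left_inv, f.right_inv⟩⟩
  · change f (t • w) = t • f w
    rw [← algebraMap_smul UAInf t w, map_smul, algebraMap_smul]
  · change f (ι x • w) = ⁅x, f w⁆
    rw [map_smul, hρ]

/-! ### Assembly of the decomposition -/

namespace NeutralFock

theorem c_lie (v : NeutralFock) : ⁅AInf.c, v⁆ = v := by
  have h := pair.act_smul_left 0 0 v
  rw [zero_smul, zero_smul] at h
  rw [lie_eq]
  change pair.act 0 v + (1 : ℂ) • v = v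
  rw [h, zero_add, one_smul]

theorem nonempty_component_equiv (n : ℤ) : Nonempty (component n ≃ₗ⁅ℂ, AInf⁆ Irr (weightHat n)) := by
  obtain ⟨v, hv, hv0, hs, -⟩ := exists_highest n
  refine nonempty_equiv_irr (isIrreducible_component n) _ (v := ⟨v, hv⟩)
    (fun h => hv0 (congrArg Subtype.val h)) (fun x hx => Subtype.ext ?_) fun h => Subtype.ext ?_
  · change ⁅x, v⁆ = 0
    obtain ⟨M, hM⟩ := (pair.act_eventually (AInf.mat x) v).exists
    rw [lie_eq, hx.1, zero_smul, add_zero, hM]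
    refine Finset.sum_eq_zero fun i _ => Finset.sum_eq_zero fun j _ => ?_
    by_cases hij : j ≤ i
    · rw [hx.2 i j hij, zero_smul]
    -- Here `i < j`. If `j ≤ n` then level `i` is filled too, and `a_i` can be moved to the right to
    -- kill the vector; otherwise level `j` is empty.
    · rw [pair.nop_apply_of_ne (by omega)]
      by_cases hj : j ≤ n
      · have hi : i ∈ Set.Iic n := Set.mem_Iic.mpr (by omega)
        rw [pair.a_b_apply, if_neg (by omega), hs.1 i hi, map_zero, sub_zero, smul_zero]
      · rw [hs.2 j hj, map_zero, smul_zero]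
  · change ⁅h.1, v⁆ = weightHat n h • v
    rw [lie_eq, pair.act_diag_isState hs h.2, ← add_smul]
    congr 1
    simp only [weightHat, weight, LinearMap.add_apply, LinearMap.sub_apply, LinearMap.sum_apply]
    rfl

theorem isInternal_component :
    DirectSum.IsInternal fun n : ℤ => (component n).toSubmodule :=
  (DirectSum.isInternal_submodule_iff_iSupIndep_and_iSup_eq_top _).mpr ⟨iSupIndep_homog, iSup_homog⟩

theorem nonempty_equiv_directSum :
    Nonempty (NeutralFock ≃ₗ⁅ℂ, AInf⁆ DirectSum ℤ fun n => Irr (weightHat n)) := by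
  let e : ∀ n : ℤ, component n ≃ₗ⁅ℂ, AInf⁆ Irr (weightHat n) :=
    fun n => (nonempty_component_equiv n).some
  let f : (DirectSum ℤ fun n => Irr (weightHat n)) ≃ₗ[ℂ] NeutralFock :=
    (DFinsupp.mapRange.linearEquiv fun n => (e n).symm.toLinearEquiv).trans
      (LinearEquiv.ofBijective
        (DirectSum.coeLinearMap fun n : ℤ => (component n).toSubmodule) isInternal_component)
  have hf : ∀ n w, f (DirectSum.of _ n w) = ((e n).symm w : NeutralFock) := by
    intro n w
    change DirectSum.coeLinearMap (fun n : ℤ => (component n).toSubmodule)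
      (DFinsupp.mapRange (fun n => (e n).symm.toLinearEquiv) (fun _ => map_zero _)
        (DFinsupp.single n w)) = _
    rw [DFinsupp.mapRange_single]
    exact DirectSum.coeLinearMap_of _ n _
  refine ⟨LieModuleEquiv.symm ⟨⟨f.toLinearMap, fun {x w} => ?_⟩, f.symm, f.left_inv, f.right_inv⟩⟩
  change f ⁅x, w⁆ = ⁅x, f w⁆
  induction w using DirectSum.induction_on with
  | zero => rw [lie_zero, map_zero, lie_zero]
  | of n w =>
    have h : ⁅x, DirectSum.of (fun n => Irr (weightHat n)) n w⁆ = DirectSum.of _ n ⁅x, w⁆ :=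
      ((DirectSum.lieModuleOf ℂ ℤ AInf (fun n => Irr (weightHat n)) n).map_lie x w).symm
    rw [h, hf, hf]
    exact congrArg Subtype.val ((e n).symm.toLieModuleHom.map_lie x w)
  | add v w hv hw => rw [lie_add, map_add, hv, hw, map_add, lie_add]

end NeutralFock

theorem ChargedFock.c_lie (v : ChargedFock) : ⁅AInf.c, v⁆ = v := by
  have h := ChargedFock.pair.act_smul_left 0 0 v
  rw [zero_smul, zero_smul] at h
  rw [ChargedFock.lie_eq]
  change ChargedFock.pair.act 0 v + (1 : ℂ) • v = v
  rw [h, zero_add, one_smul]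

end

end FermionFock

/-- The decomposition of the Fock space of a single neutral fermion, as a module over `a_∞` with
central charge `1`, and its isomorphism with the Fock space of a pair of charged fermions. -/
theorem theorem3p7 :
    (∀ v : FermionFock.NeutralFock, ⁅FermionFock.AInf.c, v⁆ = v) ∧
    (∀ n : ℤ, LieModule.IsIrreducible ℂ FermionFock.AInf (FermionFock.NeutralFock.component n)) ∧
    (∀ n : ℤ, Nonempty (FermionFock.NeutralFock.component n ≃ₗ⁅ℂ,FermionFock.AInf⁆
      FermionFock.Irr (FermionFock.weightHat n))) ∧
    DirectSum.IsInternal (fun n : ℤ => (FermionFock.NeutralFock.component n).toSubmodule) ∧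
    Nonempty (FermionFock.NeutralFock ≃ₗ⁅ℂ,FermionFock.AInf⁆
      DirectSum ℤ fun n => FermionFock.Irr (FermionFock.weightHat n)) ∧
    (∀ v : FermionFock.ChargedFock, ⁅FermionFock.AInf.c, v⁆ = v) ∧
    Nonempty (FermionFock.NeutralFock ≃ₗ⁅ℂ,FermionFock.AInf⁆ FermionFock.ChargedFock) := by
  exact ⟨FermionFock.NeutralFock.c_lie, FermionFock.NeutralFock.isIrreducible_component,
    FermionFock.NeutralFock.nonempty_component_equiv, FermionFock.NeutralFock.isInternal_component,
    FermionFock.NeutralFock.nonempty_equiv_directSum, FermionFock.ChargedFock.c_lie,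
    FermionFock.nonempty_neutral_equiv_charged⟩
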